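/- Let $S$ be a compact (connected) Riemann surface, $\Sigma\subset S$ a finite set and $S^o=S\setminus\Sigma$. Let $\nabla$ be a holomorphic connection on the tangent bundle of $S^o$; in a holomorphic chart $z$ write $\nabla(\partial/\partial z)=\eta_z\otimes\partial/\partial z$, $\eta_z=f_z\,dz$. Let $G\subseteq\mathbb{C}^*$ be a subgroup such that $\nabla$ has monodromy in $G$, i.e. $S^o$ can be covered by holomorphic charts $z$ on which $\eta_z=dK_z$ has a holomorphic primitive, chosen such that the locally constant functions $\frac{\exp K_z}{\exp K_w}\cdot\frac{\partial z}{\partial w}$ on the overlaps of the charts take values in $G$. Assume that for some integer $k\ge 1$ one has $\arg G^k=\{0\}$, i.e. $a^k$ is a positive real number for every $a\in G$. Here a geodesic of a holomorphic connection is a smooth curve $\sigma:I\to S^o$ on a non-degenerate interval $I\subseteq\mathbb{R}$ with $\nabla_{\sigma'}\sigma'\equiv 0$, i.e. $(z\circ\sigma)''+(f_z\circ\sigma)\,((z\circ\sigma)')^2=0$ in every holomorphic chart $z$; a geodesic $\sigma:[a,b]\to S^o$ with $a<b$ is closed if $\sigma(b)=\sigma(a)$ and $\sigma'(b)$ is a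 positive multiple of $\sigma'(a)$. Then there exist a compact (connected) Riemann surface $\hat S$, a possibly ramified covering $\pi:\hat S\to S$ (a surjective holomorphic map with finite fibres that is a covering map over $S\setminus\Sigma$), and a holomorphic connection $\hat\nabla$ on the tangent bundle of $\hat S^o:=\hat S\setminus\pi^{-1}(\Sigma)$ such that: 1. a smooth curve $\hat\sigma:I\to\hat S^o$ on a non-degenerate interval $I$ (for instance $I=[0,\varepsilon)$) is a geodesic of $\hat\nabla$ if and only if $\pi\circ\hat\sigma$ is a geodesic of $\nabla$; 2. every self-intersecting geodesic of $\hat\nabla$ is closed: if $\hat\sigma:I\to\hat S^o$ is a geodesic of $\hat\nabla$ and $\hat\sigma(a)=\hat\sigma(b)$ for some $a<b$ in $I$, then $\hat\sigma|_{[a,b]}$ is a closed geodesic of $\hat\nabla$. -/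

import Mathlib

open scoped Manifold ContDiff

universe u

noncomputable section

section Connection

variable {S : Type*} [TopologicalSpace S] [ChartedSpace ℂ S]

/-- Operators taking a section `X` of the holomorphic tangent bundle of a Riemann surface to a
section of `Ω¹ ⊗ TS = Hom(TS, TS)`; `cov X x v` is `∇_v X` at the point `x`. -/
abbrev TangentOperator (S : Type*) [TopologicalSpace S] [ChartedSpace ℂ S] : Type _ :=
  (Π x : S, TangentSpace 𝓘(ℂ, ℂ) x) →
    (Π x : S, TangentSpace 𝓘(ℂ, ℂ) x →L[ℂ] TangentSpace 𝓘(ℂ, ℂ) x)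

/-- `cov` is a holomorphic connection on (the tangent bundle of) the open subset `U` of `S`:
it is additive and satisfies the Leibniz rule over `U` (hence is `ℂ`-linear), and it maps
holomorphic vector fields on any open `V ⊆ U` to holomorphic sections of `Hom(TS, TS)` on `V`.
Values of `cov` at points outside `U` are irrelevant. -/
structure IsHolomorphicConnectionOn [IsManifold 𝓘(ℂ, ℂ) 1 S] (cov : TangentOperator S)
    (U : Set S) : Prop where
  isCovariantDerivativeOn :
    IsCovariantDerivativeOn (V := fun x : S ↦ TangentSpace 𝓘(ℂ, ℂ) x) ℂ cov U
  holomorphic : ∀ V : Set S, IsOpen V → V ⊆ U →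
    ContMDiffCovariantDerivativeOn (V := fun x : S ↦ TangentSpace 𝓘(ℂ, ℂ) x) ℂ ω cov V

/-- The coordinate vector field `∂/∂z` of a chart `z` (meaningful on the domain of `z`). -/
def coordField (z : OpenPartialHomeomorph S ℂ) (x : S) : TangentSpace 𝓘(ℂ, ℂ) x :=
  VectorField.mpullback 𝓘(ℂ, ℂ) 𝓘(ℂ, ℂ) z
    (fun y ↦ (NormedSpace.fromTangentSpace (𝕜 := ℂ) y).symm (1 : ℂ)) x

/-- The local representation `η` of a connection in the chart `z`, i.e. the 1-form with
`∇(∂/∂z) = η ⊗ ∂/∂z`. It is computed as `dz ∘ ∇(∂/∂z)`. -/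
def localRep (cov : TangentOperator S) (z : OpenPartialHomeomorph S ℂ) (x : S) :
    TangentSpace 𝓘(ℂ, ℂ) x →L[ℂ] ℂ :=
  (mvfderiv 𝓘(ℂ, ℂ) z x).comp (cov (coordField z) x)

/-- The coefficient `f` in `η = f dz`. -/
def localCoeff (cov : TangentOperator S) (z : OpenPartialHomeomorph S ℂ) (x : S) : ℂ :=
  localRep cov z x (coordField z x)

/-- The function `ξ = ∂z/∂w` comparing two charts, so that `∂/∂w = ξ ∂/∂z`. -/
def chartRatio (z w : OpenPartialHomeomorph S ℂ) (x : S) : ℂ :=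
  deriv (z ∘ w.symm) (w x)

/-- The connection `cov` on `U` has monodromy in the subgroup `G` of `ℂˣ`: for some covering of `U`
by holomorphic charts `z` with primitives `K z` of the local representations, the Čech cocycle
`exp (K z) / exp (K w) * ∂z/∂w` of locally constant functions takes values in `G`.
(Multiplying by a coboundary of constants amounts to adding constants to the `K z`, so this says
that the class of the cocycle in `H¹(U, ℂˣ)` comes from `H¹(U, G)`.) -/
def HasMonodromyIn (cov : TangentOperator S) (U : Set S) (G : Subgroup ℂˣ) : Prop :=
  ∃ (A : Set (OpenPartialHomeomorph S ℂ)) (K : OpenPartialHomeomorph S ℂ → S → ℂ),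
    A ⊆ IsManifold.maximalAtlas 𝓘(ℂ, ℂ) ω S ∧
    (⋃ z ∈ A, z.source) = U ∧
    (∀ z ∈ A, ∀ x ∈ z.source, MDifferentiableAt 𝓘(ℂ, ℂ) 𝓘(ℂ, ℂ) (K z) x ∧
      mvfderiv 𝓘(ℂ, ℂ) (K z) x = localRep cov z x) ∧
    ∀ z ∈ A, ∀ w ∈ A, ∀ x ∈ z.source ∩ w.source, ∃ g ∈ G,
      Complex.exp (K z x) / Complex.exp (K w x) * chartRatio z w x = (g : ℂ)

/-- `σ`, restricted to the interval `I`, is a geodesic in `U` of the connection `cov`: a smooth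
curve in `U` with `∇_{σ'} σ' = 0`, which in a holomorphic chart `z` with `η = f dz` reads
`(z ∘ σ)'' + (f ∘ σ) (z ∘ σ)' ^ 2 = 0`. Derivatives at endpoints belonging to `I` are
one-sided. -/
structure IsGeodesicOn (cov : TangentOperator S) (U : Set S) (σ : ℝ → S) (I : Set ℝ) : Prop where
  ordConnected : I.OrdConnected
  nontrivial : I.Nontrivial
  smooth : ContMDiffOn 𝓘(ℝ, ℝ) 𝓘(ℝ, ℂ) ∞ σ I
  mapsTo : Set.MapsTo σ I U
  geodesic_eq : ∀ z ∈ IsManifold.maximalAtlas 𝓘(ℂ, ℂ) ω S, ∀ t ∈ I, σ t ∈ z.source →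
    derivWithin (derivWithin (z ∘ σ) I) I t
      + localCoeff cov z (σ t) * derivWithin (z ∘ σ) I t ^ 2 = 0

/-- The geodesic `σ : [a, b] → U` is closed: `σ b = σ a` and `σ' b` is a positive multiple of
`σ' a`. The two velocities are compared in a chart around the common endpoint. -/
structure IsClosedGeodesic (cov : TangentOperator S) (U : Set S) (σ : ℝ → S) (a b : ℝ) : Prop where
  lt : a < b
  isGeodesicOn : IsGeodesicOn cov U σ (Set.Icc a b)
  eq_endpoints : σ b = σ a
  velocity : ∃ c : ℝ, 0 < c ∧
    derivWithin (chartAt ℂ (σ a) ∘ σ) (Set.Icc a b) b =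
      c • derivWithin (chartAt ℂ (σ a) ∘ σ) (Set.Icc a b) a

end Connection

/-- `π : T → S` is a (possibly ramified) holomorphic covering of Riemann surfaces with finite
fibres, whose branch points lie in `B`: it is holomorphic and surjective, its fibres are finite,
and it is a covering map over the complement of `B`. -/
structure IsRamifiedCovering {T S : Type*} [TopologicalSpace T] [ChartedSpace ℂ T]
    [TopologicalSpace S] [ChartedSpace ℂ S] (π : T → S) (B : Set S) : Prop where
  holomorphic : ContMDiff 𝓘(ℂ, ℂ) 𝓘(ℂ, ℂ) ω π
  surjective : Function.Surjective π
  finite_fiber : ∀ x, (π ⁻¹' {x}).Finite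
  isCoveringMapOn : IsCoveringMapOn π Bᶜ

end

noncomputable section

open Set Filter Topology

set_option linter.unusedSectionVars false

/-! ### Chart ratios, components of vector fields, and endomorphisms of the tangent line as scalars.
-/

section ChartCalculus

variable {S : Type*} [TopologicalSpace S] [ChartedSpace ℂ S]

/-! Off `P`, the local forms `exp(K_z) dz` are differentials of affine coordinates: in such a
coordinate the geodesic equation becomes `v' = 0` for the velocity `v = exp(K_z) (z ∘ γ)'`. Changing
the chart multiplies `v` by the monodromy cocycle. The assumption on `G` says exactly that the
direction of each cocycle value is a `k`-th root of unity, so the direction of a geodesic is well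
defined up to the finite group `CircleRoots k`.

The cover `T` removes this ambiguity. Over `Pᶜ` its points are pairs of a point `y` and a label in
`CircleRoots k`; the label corrects the direction measured in the chart `pick y`, and the topology
is the one making the corrected direction continuous. Around a puncture, the `k`-th power of the
flat direction is a single-valued circle function. Its `k`-th root has a monodromy `ζ`, and if `m`
is the order of `ζ`, the root becomes single-valued after the base change `v ↦ v ^ m`
(`exists_circle_root`). The punctures are therefore filled in by discs mapping by `v ↦ v ^ m`. This
gives a `CoverData` (`FlatAtlas.exists_coverData`), and a connected component of its total space is
the required compact surface (`CoverData.exists_connected_cover`).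

The connection on `T` is the pullback of `cov`. It is well defined because the projection is locally
biholomorphic off the branch points (`pullbackScalar_eq`), and in the charts `z ∘ π` the geodesic
equations upstairs and downstairs are the same equation. On `T` the product of label and unit
velocity is constant along a geodesic (`FlatAtlas.label_mul_unitVec_velocity_eq`). When the geodesic
returns to a point of `T`, the label is the same, so the two velocities have the same direction and
the geodesic closes up. -/

lemma analyticAt_transition [IsManifold 𝓘(ℂ, ℂ) ω S] {z w : OpenPartialHomeomorph S ℂ}
    (hz : z ∈ IsManifold.maximalAtlas 𝓘(ℂ, ℂ) ω S) (hw : w ∈ IsManifold.maximalAtlas 𝓘(ℂ, ℂ) ω S)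
    {x : S} (hxz : x ∈ z.source) (hxw : x ∈ w.source) :
    AnalyticAt ℂ (z ∘ w.symm) (w x) := by
  have h1 : ContMDiffAt 𝓘(ℂ, ℂ) 𝓘(ℂ, ℂ) ω w.symm (w x) :=
    contMDiffAt_symm_of_mem_maximalAtlas hw (w.map_source hxw)
  have h2 : ContMDiffAt 𝓘(ℂ, ℂ) 𝓘(ℂ, ℂ) ω z (w.symm (w x)) := by
    rw [w.left_inv hxw]
    exact contMDiffAt_of_mem_maximalAtlas hz hxz
  exact (h2.comp (w x) h1).contDiffAt.analyticAt

lemma eventually_symm_mem_source {z w : OpenPartialHomeomorph S ℂ} {x : S}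
    (hxz : x ∈ z.source) (hxw : x ∈ w.source) :
    ∀ᶠ y in 𝓝 (w x), y ∈ w.target ∧ w.symm y ∈ z.source := by
  refine Filter.Eventually.and (w.open_target.mem_nhds (w.map_source hxw)) ?_
  have := w.continuousAt_symm (w.map_source hxw)
  rw [ContinuousAt, w.left_inv hxw] at this
  exact this (z.open_source.mem_nhds hxz)

lemma chartRatio_self {z : OpenPartialHomeomorph S ℂ} {x : S} (hx : x ∈ z.source) :
    chartRatio z z x = 1 := by
  have : z ∘ z.symm =ᶠ[𝓝 (z x)] id := by
    filter_upwards [z.open_target.mem_nhds (z.map_source hx)] with y hy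
    exact z.right_inv hy
  rw [chartRatio, this.deriv_eq, deriv_id]

/-- The chain rule `dg/dw = dg/dz · dz/dw`; all the cocycle identities for `chartRatio` come from
it. -/
lemma deriv_comp_symm_eq [IsManifold 𝓘(ℂ, ℂ) ω S] {z w : OpenPartialHomeomorph S ℂ}
    (hz : z ∈ IsManifold.maximalAtlas 𝓘(ℂ, ℂ) ω S) (hw : w ∈ IsManifold.maximalAtlas 𝓘(ℂ, ℂ) ω S)
    {x : S} (hxz : x ∈ z.source) (hxw : x ∈ w.source) {g : S → ℂ}
    (hg : DifferentiableAt ℂ (g ∘ z.symm) (z x)) :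
    deriv (g ∘ w.symm) (w x) = deriv (g ∘ z.symm) (z x) * chartRatio z w x := by
  have h : g ∘ w.symm =ᶠ[𝓝 (w x)] (g ∘ z.symm) ∘ (z ∘ w.symm) := by
    filter_upwards [eventually_symm_mem_source hxz hxw] with y hy
    simp [z.left_inv hy.2]
  rw [h.deriv_eq, deriv_comp, chartRatio]
  · simp [w.left_inv hxw]
  · simpa [w.left_inv hxw] using hg
  · exact (analyticAt_transition hz hw hxz hxw).differentiableAt

lemma chartRatio_mul [IsManifold 𝓘(ℂ, ℂ) ω S] {z w v : OpenPartialHomeomorph S ℂ}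
    (hz : z ∈ IsManifold.maximalAtlas 𝓘(ℂ, ℂ) ω S) (hw : w ∈ IsManifold.maximalAtlas 𝓘(ℂ, ℂ) ω S)
    (hv : v ∈ IsManifold.maximalAtlas 𝓘(ℂ, ℂ) ω S)
    {x : S} (hxz : x ∈ z.source) (hxw : x ∈ w.source) (hxv : x ∈ v.source) :
    chartRatio z w x * chartRatio w v x = chartRatio z v x :=
  (deriv_comp_symm_eq hw hv hxw hxv (analyticAt_transition hz hw hxz hxw).differentiableAt).symm

lemma chartRatio_mul_symm [IsManifold 𝓘(ℂ, ℂ) ω S] {z w : OpenPartialHomeomorph S ℂ}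
    (hz : z ∈ IsManifold.maximalAtlas 𝓘(ℂ, ℂ) ω S) (hw : w ∈ IsManifold.maximalAtlas 𝓘(ℂ, ℂ) ω S)
    {x : S} (hxz : x ∈ z.source) (hxw : x ∈ w.source) :
    chartRatio z w x * chartRatio w z x = 1 := by
  rw [chartRatio_mul hz hw hz hxz hxw hxz, chartRatio_self hxz]

lemma chartRatio_ne_zero [IsManifold 𝓘(ℂ, ℂ) ω S] {z w : OpenPartialHomeomorph S ℂ}
    (hz : z ∈ IsManifold.maximalAtlas 𝓘(ℂ, ℂ) ω S) (hw : w ∈ IsManifold.maximalAtlas 𝓘(ℂ, ℂ) ω S)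
    {x : S} (hxz : x ∈ z.source) (hxw : x ∈ w.source) :
    chartRatio z w x ≠ 0 :=
  left_ne_zero_of_mul_eq_one (chartRatio_mul_symm hz hw hxz hxw)

lemma chartAt_mem_maximalAtlas [IsManifold 𝓘(ℂ, ℂ) ω S] (x : S) :
    chartAt ℂ x ∈ IsManifold.maximalAtlas 𝓘(ℂ, ℂ) ω S :=
  IsManifold.chart_mem_maximalAtlas x

lemma analyticAt_chartRatio_comp_symm [IsManifold 𝓘(ℂ, ℂ) ω S] {z w : OpenPartialHomeomorph S ℂ}
    (hz : z ∈ IsManifold.maximalAtlas 𝓘(ℂ, ℂ) ω S) (hw : w ∈ IsManifold.maximalAtlas 𝓘(ℂ, ℂ) ω S)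
    {x : S} (hxz : x ∈ z.source) (hxw : x ∈ w.source) :
    AnalyticAt ℂ (chartRatio z w ∘ w.symm) (w x) := by
  refine (analyticAt_transition hz hw hxz hxw).deriv.congr ?_
  filter_upwards [eventually_symm_mem_source hxz hxw] with y hy
  simp [chartRatio, w.right_inv hy.1]

lemma contMDiffAt_iff_comp_symm [IsManifold 𝓘(ℂ, ℂ) ω S] {z : OpenPartialHomeomorph S ℂ}
    (hz : z ∈ IsManifold.maximalAtlas 𝓘(ℂ, ℂ) ω S) {x : S} (hx : x ∈ z.source) {g : S → ℂ} :
    ContMDiffAt 𝓘(ℂ, ℂ) 𝓘(ℂ, ℂ) ω g x ↔ AnalyticAt ℂ (g ∘ z.symm) (z x) := by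
  constructor
  · intro h
    have h1 := contMDiffAt_symm_of_mem_maximalAtlas hz (z.map_source hx)
    rw [← z.left_inv hx] at h
    exact (h.comp (z x) h1).contDiffAt.analyticAt
  · intro h
    have h1 := contMDiffAt_of_mem_maximalAtlas hz hx
    refine ((h.contDiffAt.contMDiffAt).comp x h1).congr_of_eventuallyEq ?_
    filter_upwards [z.open_source.mem_nhds hx] with y hy
    simp [z.left_inv hy]

lemma mdifferentiableAt_iff_comp_symm [IsManifold 𝓘(ℂ, ℂ) ω S] {z : OpenPartialHomeomorph S ℂ}
    (hz : z ∈ IsManifold.maximalAtlas 𝓘(ℂ, ℂ) ω S) {x : S} (hx : x ∈ z.source) {g : S → ℂ} :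
    MDifferentiableAt 𝓘(ℂ, ℂ) 𝓘(ℂ, ℂ) g x ↔ DifferentiableAt ℂ (g ∘ z.symm) (z x) := by
  constructor
  · intro h
    have h1 := (contMDiffAt_symm_of_mem_maximalAtlas hz (z.map_source hx)).mdifferentiableAt
      (by simp)
    rw [← z.left_inv hx] at h
    exact (h.comp (z x) h1).differentiableAt
  · intro h
    have h1 := (contMDiffAt_of_mem_maximalAtlas hz hx).mdifferentiableAt (by simp)
    refine ((h.mdifferentiableAt).comp x h1).congr_of_eventuallyEq ?_
    filter_upwards [z.open_source.mem_nhds hx] with y hy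
    simp [z.left_inv hy]

/-- A tangent vector as a complex number, through the preferred chart at its base point. -/
def tangentVal {x : S} (v : TangentSpace 𝓘(ℂ, ℂ) x) : ℂ := v

/-- The tangent vector with a given coordinate in the preferred chart at its base point. -/
def tangentMk (x : S) (v : ℂ) : TangentSpace 𝓘(ℂ, ℂ) x := v

lemma tangentVal_smul {x : S} (c : ℂ) (v : TangentSpace 𝓘(ℂ, ℂ) x) :
    tangentVal (c • v) = c * tangentVal v := rfl

lemma tangentVal_injective {x : S} {v w : TangentSpace 𝓘(ℂ, ℂ) x}
    (h : tangentVal v = tangentVal w) : v = w := h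

lemma mvfderiv_apply_eq_deriv {g : S → ℂ} {x : S} (hg : MDifferentiableAt 𝓘(ℂ, ℂ) 𝓘(ℂ, ℂ) g x)
    (v : TangentSpace 𝓘(ℂ, ℂ) x) :
    mvfderiv 𝓘(ℂ, ℂ) g x v =
      deriv (g ∘ (chartAt ℂ x).symm) (chartAt ℂ x x) * tangentVal v := by
  rw [hg.mvfderiv]
  have h1 : (writtenInExtChartAt 𝓘(ℂ, ℂ) 𝓘(ℂ, ℂ) x g) = g ∘ (chartAt ℂ x).symm := by
    ext; simp only [mfld_simps, Function.comp, chartAt_self_eq]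
  rw [h1]
  simp only [mfld_simps, fderivWithin_univ]
  have h2 := fderiv_eq_smul_deriv (𝕜 := ℂ) (f := g ∘ (chartAt ℂ x).symm) (x := chartAt ℂ x x)
    (tangentVal v)
  rw [smul_eq_mul, mul_comm] at h2
  exact h2

lemma mvfderiv_chart [IsManifold 𝓘(ℂ, ℂ) ω S] {z : OpenPartialHomeomorph S ℂ}
    (hz : z ∈ IsManifold.maximalAtlas 𝓘(ℂ, ℂ) ω S) {x : S} (hx : x ∈ z.source)
    (v : TangentSpace 𝓘(ℂ, ℂ) x) :
    mvfderiv 𝓘(ℂ, ℂ) z x v = chartRatio z (chartAt ℂ x) x * tangentVal v :=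
  mvfderiv_apply_eq_deriv ((contMDiffAt_of_mem_maximalAtlas hz hx).mdifferentiableAt (by simp)) v

lemma mvfderiv_apply_eq [IsManifold 𝓘(ℂ, ℂ) ω S] {z : OpenPartialHomeomorph S ℂ}
    (hz : z ∈ IsManifold.maximalAtlas 𝓘(ℂ, ℂ) ω S) {x : S} (hx : x ∈ z.source) {g : S → ℂ}
    (hg : MDifferentiableAt 𝓘(ℂ, ℂ) 𝓘(ℂ, ℂ) g x) (v : TangentSpace 𝓘(ℂ, ℂ) x) :
    mvfderiv 𝓘(ℂ, ℂ) g x v =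
      deriv (g ∘ z.symm) (z x) * (chartRatio z (chartAt ℂ x) x * tangentVal v) := by
  rw [mvfderiv_apply_eq_deriv hg, deriv_comp_symm_eq hz (chartAt_mem_maximalAtlas x) hx
    (mem_chart_source ℂ x) ((mdifferentiableAt_iff_comp_symm hz hx).1 hg), mul_assoc]

lemma coordField_eq [IsManifold 𝓘(ℂ, ℂ) ω S] {z : OpenPartialHomeomorph S ℂ}
    (hz : z ∈ IsManifold.maximalAtlas 𝓘(ℂ, ℂ) ω S) {x : S} (hx : x ∈ z.source) :
    tangentVal (coordField z x) = chartRatio (chartAt ℂ x) z x := by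
  have hr := chartRatio_mul_symm hz (chartAt_mem_maximalAtlas x) hx (mem_chart_source ℂ x)
  have hr0 := chartRatio_ne_zero hz (chartAt_mem_maximalAtlas x) hx (mem_chart_source ℂ x)
  -- The pullback of a vector field uses the inverse of the derivative of `z`, so that derivative is
  -- exhibited as an invertible map: multiplication by `dz/dc` for the preferred chart `c`.
  let e : TangentSpace 𝓘(ℂ, ℂ) x ≃L[ℂ] TangentSpace 𝓘(ℂ, ℂ) (z x) :=
    ContinuousLinearEquiv.unitsEquivAut ℂ (Units.mk0 _ hr0)
  have he : mfderiv 𝓘(ℂ, ℂ) 𝓘(ℂ, ℂ) z x = (e : TangentSpace 𝓘(ℂ, ℂ) x →L[ℂ] _) := by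
    refine ContinuousLinearMap.ext fun v ↦ ?_
    have := mvfderiv_chart hz hx v
    rw [mul_comm] at this
    exact this
  rw [coordField, VectorField.mpullback_apply, he, ContinuousLinearMap.inverse_equiv]
  change (1 : ℂ) * (chartRatio z (chartAt ℂ x) x)⁻¹ = _
  rw [one_mul, inv_eq_of_mul_eq_one_right hr]

/-- The component of a vector field in a chart. -/
def component (z : OpenPartialHomeomorph S ℂ) (X : Π x : S, TangentSpace 𝓘(ℂ, ℂ) x) (x : S) : ℂ :=
  chartRatio z (chartAt ℂ x) x * tangentVal (X x)

lemma component_eq_mul [IsManifold 𝓘(ℂ, ℂ) ω S] {z w : OpenPartialHomeomorph S ℂ}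
    (hz : z ∈ IsManifold.maximalAtlas 𝓘(ℂ, ℂ) ω S) (hw : w ∈ IsManifold.maximalAtlas 𝓘(ℂ, ℂ) ω S)
    {x : S} (hxz : x ∈ z.source) (hxw : x ∈ w.source) (X : Π x : S, TangentSpace 𝓘(ℂ, ℂ) x) :
    component z X x = chartRatio z w x * component w X x := by
  rw [component, component, ← mul_assoc, chartRatio_mul hz hw (chartAt_mem_maximalAtlas x) hxz hxw
    (mem_chart_source ℂ x)]

lemma component_coordField [IsManifold 𝓘(ℂ, ℂ) ω S] {z w : OpenPartialHomeomorph S ℂ}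
    (hz : z ∈ IsManifold.maximalAtlas 𝓘(ℂ, ℂ) ω S) (hw : w ∈ IsManifold.maximalAtlas 𝓘(ℂ, ℂ) ω S)
    {x : S} (hxz : x ∈ z.source) (hxw : x ∈ w.source) :
    component z (coordField w) x = chartRatio z w x := by
  rw [component, coordField_eq hw hxw, chartRatio_mul hz (chartAt_mem_maximalAtlas x) hw hxz
    (mem_chart_source ℂ x) hxw]

lemma eq_component_smul_coordField [IsManifold 𝓘(ℂ, ℂ) ω S] {z : OpenPartialHomeomorph S ℂ}
    (hz : z ∈ IsManifold.maximalAtlas 𝓘(ℂ, ℂ) ω S) {x : S} (hx : x ∈ z.source)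
    (X : Π x : S, TangentSpace 𝓘(ℂ, ℂ) x) : X x = component z X x • coordField z x := by
  refine tangentVal_injective ?_
  rw [tangentVal_smul, coordField_eq hz hx, component, mul_right_comm, chartRatio_mul_symm hz
    (chartAt_mem_maximalAtlas x) hx (mem_chart_source ℂ x), one_mul]

lemma trivializationAt_snd_eq_component [IsManifold 𝓘(ℂ, ℂ) ω S] (x₀ : S)
    (X : Π x : S, TangentSpace 𝓘(ℂ, ℂ) x) (x : S) :
    (trivializationAt ℂ (TangentSpace 𝓘(ℂ, ℂ)) x₀ ⟨x, X x⟩).2 = component (chartAt ℂ x₀) X x := by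
  rw [TangentBundle.trivializationAt_apply]
  simp only [mfld_simps, fderivWithin_univ]
  have h2 := fderiv_eq_smul_deriv (𝕜 := ℂ) (f := chartAt ℂ x₀ ∘ (chartAt ℂ x).symm)
    (x := chartAt ℂ x x) (tangentVal (X x))
  rw [smul_eq_mul, mul_comm] at h2
  exact h2

/-- The bundle trivialization at `x` reads off the component in the preferred chart, and passing to
`z` multiplies it by a holomorphic chart ratio. -/
lemma mdifferentiableAt_section_iff [IsManifold 𝓘(ℂ, ℂ) ω S] {z : OpenPartialHomeomorph S ℂ}
    (hz : z ∈ IsManifold.maximalAtlas 𝓘(ℂ, ℂ) ω S) {x : S} (hx : x ∈ z.source)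
    (X : Π x : S, TangentSpace 𝓘(ℂ, ℂ) x) :
    MDiffAt (T% X) x ↔ DifferentiableAt ℂ (component z X ∘ z.symm) (z x) := by
  have hc := chartAt_mem_maximalAtlas (S := S) x
  have hxc := mem_chart_source ℂ x
  rw [← mdifferentiableAt_iff_comp_symm hz hx]
  have key : MDiffAt (T% X) x ↔
      MDifferentiableAt 𝓘(ℂ, ℂ) 𝓘(ℂ, ℂ) (component (chartAt ℂ x) X) x := by
    rw [mdifferentiableAt_totalSpace]
    have : (fun y ↦ (trivializationAt ℂ (TangentSpace 𝓘(ℂ, ℂ)) x ⟨y, X y⟩).2) =ᶠ[𝓝 x]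
        component (chartAt ℂ x) X := by
      filter_upwards with y
      exact trivializationAt_snd_eq_component x X y
    constructor
    · intro h
      exact h.2.congr_of_eventuallyEq this.symm
    · intro h
      exact ⟨mdifferentiableAt_id, h.congr_of_eventuallyEq this⟩
  rw [key]
  have hr : ∀ {z w : OpenPartialHomeomorph S ℂ}, z ∈ IsManifold.maximalAtlas 𝓘(ℂ, ℂ) ω S →
      w ∈ IsManifold.maximalAtlas 𝓘(ℂ, ℂ) ω S → x ∈ z.source → x ∈ w.source →
      MDifferentiableAt 𝓘(ℂ, ℂ) 𝓘(ℂ, ℂ) (component w X) x →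
      MDifferentiableAt 𝓘(ℂ, ℂ) 𝓘(ℂ, ℂ) (component z X) x := by
    intro z w hz hw hxz hxw h
    have h1 : MDifferentiableAt 𝓘(ℂ, ℂ) 𝓘(ℂ, ℂ) (chartRatio z w) x :=
      (mdifferentiableAt_iff_comp_symm hw hxw).2
        (analyticAt_chartRatio_comp_symm hz hw hxz hxw).differentiableAt
    refine (h1.mul h).congr_of_eventuallyEq ?_
    filter_upwards [z.open_source.mem_nhds hxz, w.open_source.mem_nhds hxw] with y hy hy'
    exact component_eq_mul hz hw hy hy' X
  exact ⟨hr hz hc hx hxc, hr hc hz hxc hx⟩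

lemma contMDiffAt_section_iff [IsManifold 𝓘(ℂ, ℂ) ω S] {z : OpenPartialHomeomorph S ℂ}
    (hz : z ∈ IsManifold.maximalAtlas 𝓘(ℂ, ℂ) ω S) {x : S} (hx : x ∈ z.source)
    (X : Π x : S, TangentSpace 𝓘(ℂ, ℂ) x) :
    CMDiffAt ω (T% X) x ↔ AnalyticAt ℂ (component z X ∘ z.symm) (z x) := by
  have hc := chartAt_mem_maximalAtlas (S := S) x
  have hxc := mem_chart_source ℂ x
  rw [← contMDiffAt_iff_comp_symm hz hx]
  have key : CMDiffAt ω (T% X) x ↔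
      ContMDiffAt 𝓘(ℂ, ℂ) 𝓘(ℂ, ℂ) ω (component (chartAt ℂ x) X) x := by
    rw [Bundle.contMDiffAt_totalSpace]
    have : (fun y ↦ (trivializationAt ℂ (TangentSpace 𝓘(ℂ, ℂ)) x ⟨y, X y⟩).2) =ᶠ[𝓝 x]
        component (chartAt ℂ x) X := by
      filter_upwards with y
      exact trivializationAt_snd_eq_component x X y
    constructor
    · intro h
      exact h.2.congr_of_eventuallyEq this.symm
    · intro h
      exact ⟨contMDiffAt_id, h.congr_of_eventuallyEq this⟩
  rw [key]
  have hr : ∀ {z w : OpenPartialHomeomorph S ℂ}, z ∈ IsManifold.maximalAtlas 𝓘(ℂ, ℂ) ω S →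
      w ∈ IsManifold.maximalAtlas 𝓘(ℂ, ℂ) ω S → x ∈ z.source → x ∈ w.source →
      ContMDiffAt 𝓘(ℂ, ℂ) 𝓘(ℂ, ℂ) ω (component w X) x →
      ContMDiffAt 𝓘(ℂ, ℂ) 𝓘(ℂ, ℂ) ω (component z X) x := by
    intro z w hz hw hxz hxw h
    have h1 : ContMDiffAt 𝓘(ℂ, ℂ) 𝓘(ℂ, ℂ) ω (chartRatio z w) x :=
      (contMDiffAt_iff_comp_symm hw hxw).2 (analyticAt_chartRatio_comp_symm hz hw hxz hxw)
    refine (h1.mul h).congr_of_eventuallyEq ?_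
    filter_upwards [z.open_source.mem_nhds hxz, w.open_source.mem_nhds hxw] with y hy hy'
    exact component_eq_mul hz hw hy hy' X
  exact ⟨hr hz hc hx hxc, hr hc hz hxc hx⟩

/-- Endomorphisms of a complex line are scalars. -/
def homScalar {x : S} (A : TangentSpace 𝓘(ℂ, ℂ) x →L[ℂ] TangentSpace 𝓘(ℂ, ℂ) x) : ℂ :=
  tangentVal (A (tangentMk x 1))

lemma apply_eq_homScalar_mul {x : S}
    (A : TangentSpace 𝓘(ℂ, ℂ) x →L[ℂ] TangentSpace 𝓘(ℂ, ℂ) x) (v : TangentSpace 𝓘(ℂ, ℂ) x) :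
    A v = homScalar A • v := by
  have hv : v = tangentVal v • tangentMk x 1 := (mul_one (tangentVal v)).symm
  conv_lhs => rw [hv, map_smul]
  exact mul_comm (tangentVal v) (homScalar A)

/-- The endomorphism bundle of a line bundle is canonically trivial: a scalar endomorphism has the
same matrix in every trivialization. -/
lemma contMDiffAt_hom_iff [IsManifold 𝓘(ℂ, ℂ) ω S] {x : S}
    (A : Π x : S, TangentSpace 𝓘(ℂ, ℂ) x →L[ℂ] TangentSpace 𝓘(ℂ, ℂ) x) :
    ContMDiffAt 𝓘(ℂ, ℂ) (𝓘(ℂ, ℂ).prod 𝓘(ℂ, ℂ →L[ℂ] ℂ)) ω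
      (fun y ↦ (⟨y, A y⟩ : Bundle.TotalSpace (ℂ →L[ℂ] ℂ)
        fun x : S ↦ TangentSpace 𝓘(ℂ, ℂ) x →L[ℂ] TangentSpace 𝓘(ℂ, ℂ) x)) x ↔
    ContMDiffAt 𝓘(ℂ, ℂ) 𝓘(ℂ, ℂ) ω (fun y ↦ homScalar (A y)) x := by
  rw [contMDiffAt_hom_bundle]
  have : (fun y ↦ ContinuousLinearMap.inCoordinates ℂ (TangentSpace 𝓘(ℂ, ℂ) (M := S)) ℂ
      (TangentSpace 𝓘(ℂ, ℂ) (M := S)) x y x y (A y)) =ᶠ[𝓝 x]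
      fun y ↦ homScalar (A y) • ContinuousLinearMap.id ℂ ℂ := by
    have hb := FiberBundle.mem_baseSet_trivializationAt' (F := ℂ)
      (E := TangentSpace 𝓘(ℂ, ℂ) (M := S)) x
    filter_upwards [(trivializationAt ℂ (TangentSpace 𝓘(ℂ, ℂ) (M := S)) x).open_baseSet.mem_nhds hb]
      with y hy
    refine ContinuousLinearMap.ext fun v ↦ ?_
    rw [ContinuousLinearMap.inCoordinates_eq hy hy, ContinuousLinearMap.comp_apply,
      ContinuousLinearMap.comp_apply, apply_eq_homScalar_mul, map_smul]
    congr 1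
    exact ContinuousLinearEquiv.apply_symm_apply _ v
  constructor
  · intro h
    have h2 := h.2.congr_of_eventuallyEq this.symm
    have h3 := ContMDiffAt.clm_apply h2 (contMDiffAt_const (c := (1 : ℂ)))
    simpa using h3
  · intro h
    exact ⟨contMDiffAt_id, (h.smul contMDiffAt_const).congr_of_eventuallyEq this⟩

end ChartCalculus

/-! ### The connection coefficient in a chart and its transformation law. -/

section Coefficients

variable {S : Type*} [TopologicalSpace S] [ChartedSpace ℂ S] [IsManifold 𝓘(ℂ, ℂ) ω S]

lemma hom_eq_of_homScalar_eq {x : S}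
    {A B : TangentSpace 𝓘(ℂ, ℂ) x →L[ℂ] TangentSpace 𝓘(ℂ, ℂ) x}
    (h : homScalar A = homScalar B) : A = B :=
  ContinuousLinearMap.ext fun v ↦ by rw [apply_eq_homScalar_mul, apply_eq_homScalar_mul B, h]

lemma localCoeff_eq_homScalar (cov : TangentOperator S) {z : OpenPartialHomeomorph S ℂ}
    (hz : z ∈ IsManifold.maximalAtlas 𝓘(ℂ, ℂ) ω S) {x : S} (hx : x ∈ z.source) :
    localCoeff cov z x = homScalar (cov (coordField z) x) := by
  rw [localCoeff, localRep, ContinuousLinearMap.comp_apply, apply_eq_homScalar_mul, map_smul,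
    mvfderiv_chart hz hx, coordField_eq hz hx, chartRatio_mul_symm hz
      (chartAt_mem_maximalAtlas x) hx (mem_chart_source ℂ x), smul_eq_mul, mul_one]

lemma component_coordField_self_eventuallyEq {z : OpenPartialHomeomorph S ℂ}
    (hz : z ∈ IsManifold.maximalAtlas 𝓘(ℂ, ℂ) ω S) {x : S} (hx : x ∈ z.source) :
    component z (coordField z) ∘ z.symm =ᶠ[𝓝 (z x)] fun _ ↦ 1 := by
  filter_upwards [z.open_target.mem_nhds (z.map_source hx)] with y hy
  have := z.map_target hy
  simp [component_coordField hz hz this this, chartRatio_self this]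

lemma mdifferentiableAt_coordField {z : OpenPartialHomeomorph S ℂ}
    (hz : z ∈ IsManifold.maximalAtlas 𝓘(ℂ, ℂ) ω S) {x : S} (hx : x ∈ z.source) :
    MDiffAt (T% (coordField z)) x :=
  (mdifferentiableAt_section_iff hz hx _).2 ((differentiableAt_const 1).congr_of_eventuallyEq
    (component_coordField_self_eventuallyEq hz hx))

lemma contMDiffAt_coordField {z : OpenPartialHomeomorph S ℂ}
    (hz : z ∈ IsManifold.maximalAtlas 𝓘(ℂ, ℂ) ω S) {x : S} (hx : x ∈ z.source) :
    CMDiffAt ω (T% (coordField z)) x :=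
  (contMDiffAt_section_iff hz hx _).2 (analyticAt_const.congr
    (component_coordField_self_eventuallyEq hz hx).symm)

lemma homScalar_smulRight {z : OpenPartialHomeomorph S ℂ}
    (hz : z ∈ IsManifold.maximalAtlas 𝓘(ℂ, ℂ) ω S) {x : S} (hx : x ∈ z.source) {g : S → ℂ}
    (hg : MDifferentiableAt 𝓘(ℂ, ℂ) 𝓘(ℂ, ℂ) g x) (X : Π x : S, TangentSpace 𝓘(ℂ, ℂ) x) :
    homScalar ((mvfderiv 𝓘(ℂ, ℂ) g x).smulRight (X x)) =
      deriv (g ∘ z.symm) (z x) * component z X x := by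
  rw [homScalar, ContinuousLinearMap.smulRight_apply, mvfderiv_apply_eq hz hx hg, tangentVal_smul,
    component]
  have : tangentVal (tangentMk x 1) = 1 := rfl
  rw [this]
  ring

/-- Near `x` one has `X = ξ ∂/∂z`, and the Leibniz rule gives `∇X = (dξ + ξ η) ⊗ ∂/∂z`. As an
endomorphism of the tangent line this is the scalar `ξ' + f ξ`, which does not depend on a choice of
frame. -/
lemma homScalar_covariantDerivative {cov : TangentOperator S} {U : Set S} (hU : IsOpen U)
    (hcov : IsCovariantDerivativeOn (V := fun x : S ↦ TangentSpace 𝓘(ℂ, ℂ) x) ℂ cov U)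
    {z : OpenPartialHomeomorph S ℂ} (hz : z ∈ IsManifold.maximalAtlas 𝓘(ℂ, ℂ) ω S)
    {x : S} (hx : x ∈ z.source) (hxU : x ∈ U) {X : Π x : S, TangentSpace 𝓘(ℂ, ℂ) x}
    (hX : MDiffAt (T% X) x) :
    homScalar (cov X x) =
      deriv (component z X ∘ z.symm) (z x) + localCoeff cov z x * component z X x := by
  have hg : MDifferentiableAt 𝓘(ℂ, ℂ) 𝓘(ℂ, ℂ) (component z X) x :=
    (mdifferentiableAt_iff_comp_symm hz hx).2 ((mdifferentiableAt_section_iff hz hx X).1 hX)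
  have hev : ∀ᶠ y in 𝓝 x, X y = (component z X • coordField z) y := by
    filter_upwards [z.open_source.mem_nhds hx] with y hy
    exact eq_component_smul_coordField hz hy X
  have hcf := mdifferentiableAt_coordField hz hx
  have h2 : MDiffAt (T% (component z X • coordField z)) x := by
    refine hX.congr_of_eventuallyEq ?_
    filter_upwards [hev] with y hy
    rw [hy]
  rw [hcov.congr_of_eventuallyEq hX h2 (hU.mem_nhds hxU) hev, hcov.leibniz hcf hg hxU]
  have h3 : homScalar (component z X x • cov (coordField z) x +
      (mvfderiv 𝓘(ℂ, ℂ) (component z X) x).smulRight (coordField z x)) =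
      component z X x * homScalar (cov (coordField z) x) +
      homScalar ((mvfderiv 𝓘(ℂ, ℂ) (component z X) x).smulRight (coordField z x)) := rfl
  rw [h3, homScalar_smulRight hz hx hg, ← localCoeff_eq_homScalar cov hz hx,
    component_coordField hz hz hx hx, chartRatio_self hx]
  ring

/-- The transformation law of the connection coefficient under a change of charts. -/
lemma localCoeff_change {cov : TangentOperator S} {U : Set S} (hU : IsOpen U)
    (hcov : IsCovariantDerivativeOn (V := fun x : S ↦ TangentSpace 𝓘(ℂ, ℂ) x) ℂ cov U)
    {z w : OpenPartialHomeomorph S ℂ} (hz : z ∈ IsManifold.maximalAtlas 𝓘(ℂ, ℂ) ω S)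
    (hw : w ∈ IsManifold.maximalAtlas 𝓘(ℂ, ℂ) ω S)
    {x : S} (hxz : x ∈ z.source) (hxw : x ∈ w.source) (hxU : x ∈ U) :
    localCoeff cov w x =
      deriv (chartRatio z w ∘ z.symm) (z x) + localCoeff cov z x * chartRatio z w x := by
  -- The previous formula is applied to `∂/∂w`, whose component in the chart `z` is `∂z/∂w`.
  rw [localCoeff_eq_homScalar cov hw hxw, homScalar_covariantDerivative hU hcov hz hxz hxU
    (mdifferentiableAt_coordField hw hxw), component_coordField hz hw hxz hxw]
  congr 1
  refine EventuallyEq.deriv_eq ?_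
  filter_upwards [eventually_symm_mem_source hxw hxz] with y hy
  exact component_coordField hz hw (z.map_target hy.1) hy.2

lemma analyticAt_localCoeff_comp_symm {cov : TangentOperator S} {U : Set S} (hU : IsOpen U)
    (hcov : IsHolomorphicConnectionOn cov U)
    {z : OpenPartialHomeomorph S ℂ} (hz : z ∈ IsManifold.maximalAtlas 𝓘(ℂ, ℂ) ω S)
    {x : S} (hx : x ∈ z.source) (hxU : x ∈ U) :
    AnalyticAt ℂ (localCoeff cov z ∘ z.symm) (z x) := by
  rw [← contMDiffAt_iff_comp_symm hz hx]
  -- The coordinate field is holomorphic only on the domain of `z`, so the connection is restricted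
  -- to that domain.
  have hV : IsOpen (U ∩ z.source) := hU.inter z.open_source
  have h1 := (hcov.holomorphic (U ∩ z.source) hV inter_subset_left).contMDiff
    (σ := coordField z) (fun y hy ↦ (contMDiffAt_coordField hz hy.2).contMDiffWithinAt)
  have h2 := (contMDiffAt_hom_iff (fun y ↦ cov (coordField z) y)).1
    ((h1 x ⟨hxU, hx⟩).contMDiffAt (hV.mem_nhds ⟨hxU, hx⟩))
  refine h2.congr_of_eventuallyEq ?_
  filter_upwards [z.open_source.mem_nhds hx] with y hy
  exact localCoeff_eq_homScalar cov hz hy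

end Coefficients

/-! ### The geodesic equation in different charts and on subintervals. -/

section Geodesics

variable {S : Type*} [TopologicalSpace S] [ChartedSpace ℂ S]

lemma Set.OrdConnected.uniqueDiffOn_real {I : Set ℝ} (h : I.OrdConnected) (hn : I.Nontrivial) :
    UniqueDiffOn ℝ I := by
  obtain ⟨a, ha, b, hb, hab⟩ := hn.exists_lt
  refine uniqueDiffOn_convex h.convex ?_
  exact (nonempty_Ioo.2 hab).mono ((interior_Icc (a := a) (b := b)) ▸
    interior_mono (h.out ha hb))

/-- Real smoothness of a curve can be tested in any holomorphic chart, since the transition maps are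
complex analytic and hence smooth over `ℝ`. -/
lemma contMDiffWithinAt_curve_iff [IsManifold 𝓘(ℂ, ℂ) ω S] {z : OpenPartialHomeomorph S ℂ}
    (hz : z ∈ IsManifold.maximalAtlas 𝓘(ℂ, ℂ) ω S) {σ : ℝ → S} {I : Set ℝ} {t : ℝ}
    (hx : σ t ∈ z.source) :
    ContMDiffWithinAt 𝓘(ℝ, ℝ) 𝓘(ℝ, ℂ) ∞ σ I t ↔
      ContinuousWithinAt σ I t ∧ ContDiffWithinAt ℝ ∞ (z ∘ σ) I t := by
  have hc := chartAt_mem_maximalAtlas (S := S) (σ t)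
  have hxc := mem_chart_source ℂ (σ t)
  have key : ContMDiffWithinAt 𝓘(ℝ, ℝ) 𝓘(ℝ, ℂ) ∞ σ I t ↔
      ContinuousWithinAt σ I t ∧ ContDiffWithinAt ℝ ∞ (chartAt ℂ (σ t) ∘ σ) I t := by
    rw [contMDiffWithinAt_iff]
    simp only [mfld_simps]
    rfl
  rw [key]
  have hr : ∀ {z w : OpenPartialHomeomorph S ℂ}, z ∈ IsManifold.maximalAtlas 𝓘(ℂ, ℂ) ω S →
      w ∈ IsManifold.maximalAtlas 𝓘(ℂ, ℂ) ω S → σ t ∈ z.source → σ t ∈ w.source →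
      ContinuousWithinAt σ I t → ContDiffWithinAt ℝ ∞ (w ∘ σ) I t →
      ContDiffWithinAt ℝ ∞ (z ∘ σ) I t := by
    intro z w hz hw hxz hxw hcont h
    have h1 : ContDiffAt ℝ ∞ (z ∘ w.symm) ((w ∘ σ) t) :=
      ((analyticAt_transition hz hw hxz hxw).contDiffAt (n := ∞)).restrict_scalars ℝ
    refine (h1.comp_contDiffWithinAt t h).congr_of_eventuallyEq ?_ (by simp [w.left_inv hxw])
    filter_upwards [hcont (w.open_source.mem_nhds hxw)] with s hs
    simp [w.left_inv hs]
  exact ⟨fun h ↦ ⟨h.1, hr hz hc hx hxc h.1 h.2⟩, fun h ↦ ⟨h.1, hr hc hz hxc hx h.1 h.2⟩⟩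

/-- The left-hand side of the geodesic equation in a chart. -/
def geodesicDefect (cov : TangentOperator S) (z : OpenPartialHomeomorph S ℂ) (σ : ℝ → S)
    (I : Set ℝ) (t : ℝ) : ℂ :=
  derivWithin (derivWithin (z ∘ σ) I) I t
      + localCoeff cov z (σ t) * derivWithin (z ∘ σ) I t ^ 2

lemma derivWithin_chart_change [IsManifold 𝓘(ℂ, ℂ) ω S] {z w : OpenPartialHomeomorph S ℂ}
    (hz : z ∈ IsManifold.maximalAtlas 𝓘(ℂ, ℂ) ω S) (hw : w ∈ IsManifold.maximalAtlas 𝓘(ℂ, ℂ) ω S)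
    {σ : ℝ → S} {I : Set ℝ} (hI : UniqueDiffOn ℝ I) {t : ℝ} (ht : t ∈ I)
    (hσ : ContMDiffWithinAt 𝓘(ℝ, ℝ) 𝓘(ℝ, ℂ) ∞ σ I t)
    (hxz : σ t ∈ z.source) (hxw : σ t ∈ w.source) :
    derivWithin (z ∘ σ) I t = chartRatio z w (σ t) * derivWithin (w ∘ σ) I t := by
  obtain ⟨hcont, hd⟩ := (contMDiffWithinAt_curve_iff hw hxw).1 hσ
  have h1 : HasDerivAt (z ∘ w.symm) (chartRatio z w (σ t)) ((w ∘ σ) t) :=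
    (analyticAt_transition hz hw hxz hxw).differentiableAt.hasDerivAt
  have h2 := (hd.differentiableWithinAt (by simp)).hasDerivWithinAt
  have h3 := (h1.comp_hasDerivWithinAt t h2).congr_of_eventuallyEq (f₁ := z ∘ σ) (by
    filter_upwards [hcont (w.open_source.mem_nhds hxw)] with s hs
    simp [w.left_inv hs]) (by simp [w.left_inv hxw])
  exact h3.derivWithin (hI t ht)

/-- The defect `∇_{σ'} σ'` is a tangent vector along the curve, so it scales by the chart ratio. It
is therefore enough to check the equation in one chart at each time. -/
lemma geodesicDefect_change [IsManifold 𝓘(ℂ, ℂ) ω S] {cov : TangentOperator S} {U : Set S}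
    (hU : IsOpen U)
    (hcov : IsCovariantDerivativeOn (V := fun x : S ↦ TangentSpace 𝓘(ℂ, ℂ) x) ℂ cov U)
    {z w : OpenPartialHomeomorph S ℂ}
    (hz : z ∈ IsManifold.maximalAtlas 𝓘(ℂ, ℂ) ω S) (hw : w ∈ IsManifold.maximalAtlas 𝓘(ℂ, ℂ) ω S)
    {σ : ℝ → S} {I : Set ℝ} (hI : UniqueDiffOn ℝ I)
    (hσ : ContMDiffOn 𝓘(ℝ, ℝ) 𝓘(ℝ, ℂ) ∞ σ I) {t : ℝ} (ht : t ∈ I) (htU : σ t ∈ U)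
    (hxz : σ t ∈ z.source) (hxw : σ t ∈ w.source) :
    geodesicDefect cov z σ I t = chartRatio z w (σ t) * geodesicDefect cov w σ I t := by
  obtain ⟨hcont, hd⟩ := (contMDiffWithinAt_curve_iff hw hxw).1 (hσ t ht)
  have hρ : HasDerivAt (chartRatio z w ∘ w.symm) (deriv (chartRatio z w ∘ w.symm) (w (σ t)))
      ((w ∘ σ) t) :=
    (analyticAt_chartRatio_comp_symm hz hw hxz hxw).differentiableAt.hasDerivAt
  have h2 := (hd.differentiableWithinAt (by simp)).hasDerivWithinAt
  have h2' : HasDerivWithinAt (derivWithin (w ∘ σ) I) (derivWithin (derivWithin (w ∘ σ) I) I t) I t :=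
    ((hd.derivWithin hI (m := 1) (by norm_cast) ht).differentiableWithinAt
      (by simp)).hasDerivWithinAt
  have hprod := (hρ.comp_hasDerivWithinAt t h2).mul h2'
  have hev : derivWithin (z ∘ σ) I =ᶠ[𝓝[I] t]
      ((chartRatio z w ∘ w.symm) ∘ (w ∘ σ)) * derivWithin (w ∘ σ) I := by
    filter_upwards [hcont (z.open_source.mem_nhds hxz), hcont (w.open_source.mem_nhds hxw),
      self_mem_nhdsWithin] with s hsz hsw hs
    rw [derivWithin_chart_change hz hw hI hs (hσ s hs) hsz hsw]
    simp [w.left_inv hsw]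
  have h3 := (hprod.congr_of_eventuallyEq hev (hev.self_of_nhdsWithin ht)).derivWithin (hI t ht)
  have hzw := chartRatio_mul_symm hz hw hxz hxw
  have hc := localCoeff_change hU hcov hz hw hxz hxw htU
  have hD := deriv_comp_symm_eq hw hz hxw hxz
    (analyticAt_chartRatio_comp_symm hz hw hxz hxw).differentiableAt
  rw [geodesicDefect, geodesicDefect, h3, derivWithin_chart_change hz hw hI ht (hσ t ht) hxz hxw,
    hc, hD]
  simp only [Function.comp_apply, w.left_inv hxw]
  -- The derivative of the chart ratio occurs once from differentiating the velocity twice and once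
  -- from `localCoeff_change`; the two terms cancel.
  linear_combination (-(deriv (chartRatio z w ∘ w.symm) (w (σ t)) *
    derivWithin (w ∘ σ) I t ^ 2)) * hzw

lemma geodesic_eq_of_chart [IsManifold 𝓘(ℂ, ℂ) ω S] {cov : TangentOperator S} {U : Set S}
    (hU : IsOpen U)
    (hcov : IsCovariantDerivativeOn (V := fun x : S ↦ TangentSpace 𝓘(ℂ, ℂ) x) ℂ cov U)
    {z w : OpenPartialHomeomorph S ℂ}
    (hz : z ∈ IsManifold.maximalAtlas 𝓘(ℂ, ℂ) ω S) (hw : w ∈ IsManifold.maximalAtlas 𝓘(ℂ, ℂ) ω S)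
    {σ : ℝ → S} {I : Set ℝ} (hI : UniqueDiffOn ℝ I)
    (hσ : ContMDiffOn 𝓘(ℝ, ℝ) 𝓘(ℝ, ℂ) ∞ σ I) {t : ℝ} (ht : t ∈ I) (htU : σ t ∈ U)
    (hxz : σ t ∈ z.source) (hxw : σ t ∈ w.source) (h : geodesicDefect cov w σ I t = 0) :
    geodesicDefect cov z σ I t = 0 := by
  rw [geodesicDefect_change hU hcov hz hw hI hσ ht htU hxz hxw, h, mul_zero]

/-- A nontrivial interval has unique derivatives, so derivatives within `J` agree with those within
`I`, also at new endpoints where they become one-sided. -/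
lemma IsGeodesicOn.mono [IsManifold 𝓘(ℂ, ℂ) ω S] {cov : TangentOperator S} {U : Set S}
    {σ : ℝ → S} {I J : Set ℝ}
    (h : IsGeodesicOn cov U σ I) (hJ : J.OrdConnected) (hJn : J.Nontrivial) (hJI : J ⊆ I) :
    IsGeodesicOn cov U σ J where
  ordConnected := hJ
  nontrivial := hJn
  smooth := h.smooth.mono hJI
  mapsTo := h.mapsTo.mono_left hJI
  geodesic_eq z hz t ht hx := by
    have hI := h.ordConnected.uniqueDiffOn_real h.nontrivial
    have hJu := hJ.uniqueDiffOn_real hJn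
    obtain ⟨hcont, hd⟩ := (contMDiffWithinAt_curve_iff hz hx).1 (h.smooth t (hJI ht))
    have h1 : ∀ s ∈ J, σ s ∈ z.source →
        derivWithin (z ∘ σ) J s = derivWithin (z ∘ σ) I s := by
      intro s hs hsz
      obtain ⟨-, hd⟩ := (contMDiffWithinAt_curve_iff hz hsz).1 (h.smooth s (hJI hs))
      exact ((hd.differentiableWithinAt (by simp)).hasDerivWithinAt.mono hJI).derivWithin (hJu s hs)
    have hev : derivWithin (z ∘ σ) J =ᶠ[𝓝[J] t] derivWithin (z ∘ σ) I := by
      filter_upwards [(hcont.mono hJI) (z.open_source.mem_nhds hx), self_mem_nhdsWithin] with s hsz hs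
      exact h1 s hs hsz
    have h2' : HasDerivWithinAt (derivWithin (z ∘ σ) I)
        (derivWithin (derivWithin (z ∘ σ) I) I t) I t :=
      ((hd.derivWithin hI (m := 1) (by norm_cast) (hJI ht)).differentiableWithinAt
        (by simp)).hasDerivWithinAt
    rw [((h2'.mono hJI).congr_of_eventuallyEq hev (hev.self_of_nhdsWithin ht)).derivWithin
      (hJu t ht), h1 t ht hx]
    exact h.geodesic_eq z hz t (hJI ht) hx

end Geodesics

/-! ### Pulling back a connection along a locally biholomorphic map. -/

section PullbackConnection

variable {S : Type*} [TopologicalSpace S] [ChartedSpace ℂ S] [IsManifold 𝓘(ℂ, ℂ) ω S]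
variable {T : Type*} [TopologicalSpace T] [ChartedSpace ℂ T] [IsManifold 𝓘(ℂ, ℂ) ω T]

/-- A local inverse system for `π`: `φ` is a partial biholomorphism whose underlying map is `π`. -/
structure IsBranch (π : T → S) (φ : OpenPartialHomeomorph T S) : Prop where
  coe_eq : ⇑φ = π
  contMDiffOn : ContMDiffOn 𝓘(ℂ, ℂ) 𝓘(ℂ, ℂ) ω φ φ.source
  contMDiffOn_symm : ContMDiffOn 𝓘(ℂ, ℂ) 𝓘(ℂ, ℂ) ω φ.symm φ.target

lemma IsBranch.trans_mem_maximalAtlas {π : T → S} {φ : OpenPartialHomeomorph T S}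
    (hφ : IsBranch π φ) {z : OpenPartialHomeomorph S ℂ}
    (hz : z ∈ IsManifold.maximalAtlas 𝓘(ℂ, ℂ) ω S) :
    φ.trans z ∈ IsManifold.maximalAtlas 𝓘(ℂ, ℂ) ω T := by
  refine OpenPartialHomeomorph.mem_maximalAtlas_of_contMDiffOn _ ?_ ?_
  · refine (contMDiffOn_of_mem_maximalAtlas hz).comp (hφ.contMDiffOn.mono ?_) ?_
    · intro x hx
      rw [OpenPartialHomeomorph.trans_source] at hx
      exact hx.1
    · intro x hx
      rw [OpenPartialHomeomorph.trans_source] at hx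
      exact hx.2
  · refine hφ.contMDiffOn_symm.comp ((contMDiffOn_symm_of_mem_maximalAtlas hz).mono ?_) ?_
    · intro x hx
      rw [OpenPartialHomeomorph.trans_target] at hx
      exact hx.1
    · intro x hx
      rw [OpenPartialHomeomorph.trans_target] at hx
      exact hx.2

lemma IsBranch.mem_trans_source {π : T → S} {φ : OpenPartialHomeomorph T S} (hφ : IsBranch π φ)
    {z : OpenPartialHomeomorph S ℂ} {t : T} (ht : t ∈ φ.source) (htz : π t ∈ z.source) :
    t ∈ (φ.trans z).source := by
  rw [OpenPartialHomeomorph.trans_source]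
  exact ⟨ht, by rwa [mem_preimage, hφ.coe_eq]⟩

lemma IsBranch.of_mem_trans_source {π : T → S} {φ : OpenPartialHomeomorph T S}
    (hφ : IsBranch π φ) {z : OpenPartialHomeomorph S ℂ} {t : T} (ht : t ∈ (φ.trans z).source) :
    t ∈ φ.source ∧ π t ∈ z.source := by
  rw [OpenPartialHomeomorph.trans_source] at ht
  exact ⟨ht.1, by rw [← hφ.coe_eq]; exact ht.2⟩

lemma IsBranch.coe_trans {π : T → S} {φ : OpenPartialHomeomorph T S} (hφ : IsBranch π φ)
    (z : OpenPartialHomeomorph S ℂ) : ⇑(φ.trans z) = z ∘ π := by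
  rw [OpenPartialHomeomorph.coe_trans, hφ.coe_eq]

lemma IsBranch.eventually_map_symm {π : T → S} {φ : OpenPartialHomeomorph T S}
    (hφ : IsBranch π φ) {z : OpenPartialHomeomorph S ℂ} {t : T}
    (ht : t ∈ (φ.trans z).source) :
    ∀ᶠ y in 𝓝 (z (π t)), y ∈ z.target ∧ (φ.trans z).symm y ∈ (φ.trans z).source ∧
      π ((φ.trans z).symm y) = z.symm y := by
  have h1 := (φ.trans z).map_source ht
  have h2 : (φ.trans z) t = z (π t) := by rw [hφ.coe_trans]; rfl
  rw [h2] at h1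
  filter_upwards [(φ.trans z).open_target.mem_nhds h1] with y hy
  refine ⟨?_, (φ.trans z).map_target hy, ?_⟩
  · rw [OpenPartialHomeomorph.trans_target] at hy
    exact hy.1
  · rw [OpenPartialHomeomorph.trans_target] at hy
    rw [← hφ.coe_eq]
    exact φ.right_inv hy.2

lemma IsBranch.comp_eventuallyEq {π : T → S} {φ : OpenPartialHomeomorph T S}
    (hφ : IsBranch π φ) {z : OpenPartialHomeomorph S ℂ} {t : T}
    (ht : t ∈ (φ.trans z).source) {E : Type*} (g : S → E) :
    (g ∘ π) ∘ (φ.trans z).symm =ᶠ[𝓝 (z (π t))] g ∘ z.symm := by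
  filter_upwards [hφ.eventually_map_symm ht] with y hy
  simp only [Function.comp_apply, hy.2.2]

/-- Both charts factor through `π`, so only `z` and `w` matter, even when the branches `φ` and `ψ`
are different. -/
lemma IsBranch.chartRatio_trans {π : T → S} {φ ψ : OpenPartialHomeomorph T S}
    (hφ : IsBranch π φ) (hψ : IsBranch π ψ) {z w : OpenPartialHomeomorph S ℂ} {t : T}
    (htw : t ∈ (ψ.trans w).source) :
    chartRatio (φ.trans z) (ψ.trans w) t = chartRatio z w (π t) := by
  rw [chartRatio, chartRatio, hφ.coe_trans, hψ.coe_trans]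
  exact (hψ.comp_eventuallyEq htw z).deriv_eq

/-- The scalar by which the pulled back connection acts, computed in the charts `z ∘ π`. -/
def pullbackScalar (π : T → S) (cov : TangentOperator S) (φ : OpenPartialHomeomorph T S)
    (z : OpenPartialHomeomorph S ℂ) (X : Π t : T, TangentSpace 𝓘(ℂ, ℂ) t) (t : T) : ℂ :=
  deriv (component (φ.trans z) X ∘ (φ.trans z).symm) (z (π t)) +
    localCoeff cov z (π t) * component (φ.trans z) X t

/-- The scalar `ξ' + f ξ` is independent of the branch and the chart: the derivative of the chart
ratio produced by the product rule is absorbed by `localCoeff_change`. This makes the pointwise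
choices in `pullbackConnection` harmless. -/
lemma pullbackScalar_eq {π : T → S} {cov : TangentOperator S} {U : Set S} (hU : IsOpen U)
    (hcov : IsCovariantDerivativeOn (V := fun x : S ↦ TangentSpace 𝓘(ℂ, ℂ) x) ℂ cov U)
    {φ ψ : OpenPartialHomeomorph T S} (hφ : IsBranch π φ) (hψ : IsBranch π ψ)
    {z w : OpenPartialHomeomorph S ℂ} (hz : z ∈ IsManifold.maximalAtlas 𝓘(ℂ, ℂ) ω S)
    (hw : w ∈ IsManifold.maximalAtlas 𝓘(ℂ, ℂ) ω S) {t : T}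
    (htz : t ∈ (φ.trans z).source) (htw : t ∈ (ψ.trans w).source) (htU : π t ∈ U)
    {X : Π t : T, TangentSpace 𝓘(ℂ, ℂ) t} (hX : MDiffAt (T% X) t) :
    pullbackScalar π cov φ z X t = pullbackScalar π cov ψ w X t := by
  have hz' := hφ.trans_mem_maximalAtlas hz
  have hw' := hψ.trans_mem_maximalAtlas hw
  have hpz := (hφ.of_mem_trans_source htz).2
  have hpw := (hψ.of_mem_trans_source htw).2
  have hXw := (mdifferentiableAt_section_iff hw' htw X).1 hX
  have hzt : (φ.trans z) t = z (π t) := congrFun (hφ.coe_trans z) t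
  have hwt : (ψ.trans w) t = w (π t) := congrFun (hψ.coe_trans w) t
  have hXw' := deriv_comp_symm_eq hw' hz' htw htz hXw
  rw [hψ.chartRatio_trans hφ htz, hzt, hwt] at hXw'
  have hXwz : DifferentiableAt ℂ (component (ψ.trans w) X ∘ (φ.trans z).symm) (z (π t)) := by
    have h := (mdifferentiableAt_iff_comp_symm hw' htw).2 hXw
    rw [← hzt]
    exact (mdifferentiableAt_iff_comp_symm hz' htz).1 h
  have hr : DifferentiableAt ℂ (chartRatio z w ∘ z.symm) (z (π t)) := by
    refine (mdifferentiableAt_iff_comp_symm hz hpz).1 ?_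
    exact (mdifferentiableAt_iff_comp_symm hw hpw).2
      (analyticAt_chartRatio_comp_symm hz hw hpz hpw).differentiableAt
  have hev : component (φ.trans z) X ∘ (φ.trans z).symm =ᶠ[𝓝 (z (π t))]
      (chartRatio z w ∘ z.symm) * (component (ψ.trans w) X ∘ (φ.trans z).symm) := by
    have h1 := eventually_symm_mem_source htw htz
    rw [hzt] at h1
    filter_upwards [hφ.eventually_map_symm htz, h1] with y hy hy'
    simp only [Pi.mul_apply, Function.comp_apply]
    rw [component_eq_mul hz' hw' hy.2.1 hy'.2, hφ.chartRatio_trans hψ hy'.2, hy.2.2]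
  have hleft : (φ.trans z).symm (z (π t)) = t := by rw [← hzt]; exact (φ.trans z).left_inv htz
  rw [pullbackScalar, pullbackScalar, hev.deriv_eq, deriv_mul hr hXwz, hXw',
    component_eq_mul hz' hw' htz htw, hφ.chartRatio_trans hψ htw,
    localCoeff_change hU hcov hz hw hpz hpw htU]
  simp only [Function.comp_apply, hleft, z.left_inv hpz]
  linear_combination deriv (component (ψ.trans w) X ∘ (ψ.trans w).symm) (w (π t)) *
    chartRatio_mul_symm hz hw hpz hpw

open Classical in
/-- The pullback of a connection along a map which is locally biholomorphic on `V`. -/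
def pullbackConnection (π : T → S) (cov : TangentOperator S) (V : Set T)
    (h : ∀ t ∈ V, ∃ φ : OpenPartialHomeomorph T S, IsBranch π φ ∧ t ∈ φ.source) :
    TangentOperator T := fun X t ↦
  if ht : t ∈ V then
    pullbackScalar π cov (h t ht).choose (chartAt ℂ (π t)) X t •
      ContinuousLinearMap.id ℂ (TangentSpace 𝓘(ℂ, ℂ) t)
  else 0

lemma homScalar_smul_id {t : T} (c : ℂ) :
    homScalar (c • ContinuousLinearMap.id ℂ (TangentSpace 𝓘(ℂ, ℂ) t)) = c := mul_one c

section

variable {π : T → S} {cov : TangentOperator S} {U : Set S} {V : Set T}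
  (h : ∀ t ∈ V, ∃ φ : OpenPartialHomeomorph T S, IsBranch π φ ∧ t ∈ φ.source)

lemma exists_trans_source {t : T} (ht : t ∈ V) : ∃ φ : OpenPartialHomeomorph T S, IsBranch π φ ∧
    t ∈ (φ.trans (chartAt ℂ (π t))).source ∧ ∀ X : Π t : T, TangentSpace 𝓘(ℂ, ℂ) t,
      pullbackConnection π cov V h X t = pullbackScalar π cov φ (chartAt ℂ (π t)) X t •
        ContinuousLinearMap.id ℂ (TangentSpace 𝓘(ℂ, ℂ) t) := by
  have hs := (h t ht).choose_spec
  refine ⟨(h t ht).choose, hs.1, hs.1.mem_trans_source hs.2 (mem_chart_source ℂ _), fun X ↦ ?_⟩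
  rw [pullbackConnection, dif_pos ht]

lemma homScalar_pullbackConnection (hU : IsOpen U)
    (hcov : IsCovariantDerivativeOn (V := fun x : S ↦ TangentSpace 𝓘(ℂ, ℂ) x) ℂ cov U)
    {φ : OpenPartialHomeomorph T S} (hφ : IsBranch π φ)
    {z : OpenPartialHomeomorph S ℂ} (hz : z ∈ IsManifold.maximalAtlas 𝓘(ℂ, ℂ) ω S) {t : T}
    (htz : t ∈ (φ.trans z).source) (htU : π t ∈ U) (htV : t ∈ V)
    {X : Π t : T, TangentSpace 𝓘(ℂ, ℂ) t} (hX : MDiffAt (T% X) t) :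
    homScalar (pullbackConnection π cov V h X t) = pullbackScalar π cov φ z X t := by
  obtain ⟨ψ, hψ, hψt, e⟩ := exists_trans_source (cov := cov) h htV
  rw [e, homScalar_smul_id]
  exact pullbackScalar_eq hU hcov hψ hφ (chartAt_mem_maximalAtlas _) hz hψt htz htU hX

lemma isCovariantDerivativeOn_pullbackConnection :
    IsCovariantDerivativeOn (V := fun x : T ↦ TangentSpace 𝓘(ℂ, ℂ) x) ℂ
      (pullbackConnection π cov V h) V where
  add {X Y t} hX hY ht := by
    obtain ⟨φ, hφ, hφt, e⟩ := exists_trans_source (cov := cov) h ht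
    have hz := hφ.trans_mem_maximalAtlas (chartAt_mem_maximalAtlas (π t))
    have hzt : (φ.trans (chartAt ℂ (π t))) t = chartAt ℂ (π t) (π t) :=
      congrFun (hφ.coe_trans (chartAt ℂ (π t))) t
    have hX' := (mdifferentiableAt_section_iff hz hφt X).1 hX
    have hY' := (mdifferentiableAt_section_iff hz hφt Y).1 hY
    rw [hzt] at hX' hY'
    simp only [e, ← add_smul]
    congr 1
    have hadd : component (φ.trans (chartAt ℂ (π t))) (X + Y) =
        component (φ.trans (chartAt ℂ (π t))) X + component (φ.trans (chartAt ℂ (π t))) Y := by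
      ext s
      exact mul_add _ (tangentVal (X s)) (tangentVal (Y s))
    have hadd' : component (φ.trans (chartAt ℂ (π t))) (X + Y) ∘
        (φ.trans (chartAt ℂ (π t))).symm =
        component (φ.trans (chartAt ℂ (π t))) X ∘ (φ.trans (chartAt ℂ (π t))).symm +
        component (φ.trans (chartAt ℂ (π t))) Y ∘ (φ.trans (chartAt ℂ (π t))).symm := by
      rw [hadd]; rfl
    rw [pullbackScalar, hadd', deriv_add hX' hY', hadd, pullbackScalar, pullbackScalar,
      Pi.add_apply]
    ring
  leibniz {X g t} hX hg ht := by
    obtain ⟨φ, hφ, hφt, e⟩ := exists_trans_source (cov := cov) h ht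
    have hz := hφ.trans_mem_maximalAtlas (chartAt_mem_maximalAtlas (π t))
    have hzt : (φ.trans (chartAt ℂ (π t))) t = chartAt ℂ (π t) (π t) :=
      congrFun (hφ.coe_trans (chartAt ℂ (π t))) t
    have hX' := (mdifferentiableAt_section_iff hz hφt X).1 hX
    have hg' := (mdifferentiableAt_iff_comp_symm hz hφt).1 hg
    have hleft := (φ.trans (chartAt ℂ (π t))).left_inv hφt
    rw [hzt] at hX' hg' hleft
    refine hom_eq_of_homScalar_eq ?_
    have hsum : ∀ A B : TangentSpace 𝓘(ℂ, ℂ) t →L[ℂ] TangentSpace 𝓘(ℂ, ℂ) t,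
      homScalar (g t • A + B) = g t * homScalar A + homScalar B := fun _ _ ↦ rfl
    have hmul : component (φ.trans (chartAt ℂ (π t))) (g • X) =
        g * component (φ.trans (chartAt ℂ (π t))) X := by
      ext s
      exact mul_left_comm _ (g s) (tangentVal (X s))
    have hmul' : component (φ.trans (chartAt ℂ (π t))) (g • X) ∘
        (φ.trans (chartAt ℂ (π t))).symm =
        (g ∘ (φ.trans (chartAt ℂ (π t))).symm) *
        (component (φ.trans (chartAt ℂ (π t))) X ∘ (φ.trans (chartAt ℂ (π t))).symm) := by
      rw [hmul]; rfl
    rw [hsum, homScalar_smulRight hz hφt hg, e, e, homScalar_smul_id, homScalar_smul_id,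
      pullbackScalar, hmul', deriv_mul hg' hX', hmul, pullbackScalar, Pi.mul_apply, hzt]
    simp only [Function.comp_apply] at hleft ⊢
    rw [hleft]
    ring

lemma isHolomorphicConnectionOn_pullbackConnection (hU : IsOpen U)
    (hcov : IsHolomorphicConnectionOn cov U) (hVU : MapsTo π V U) :
    IsHolomorphicConnectionOn (pullbackConnection π cov V h) V where
  isCovariantDerivativeOn := isCovariantDerivativeOn_pullbackConnection h
  holomorphic W hW hWV := ⟨by
    intro X hX t ht
    refine ContMDiffAt.contMDiffWithinAt ?_
    rw [contMDiffAt_hom_iff]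
    obtain ⟨φ, hφ, hφt, -⟩ := exists_trans_source (cov := cov) h (hWV ht)
    have hc := chartAt_mem_maximalAtlas (π t)
    have hz := hφ.trans_mem_maximalAtlas hc
    have hzt : (φ.trans (chartAt ℂ (π t))) t = chartAt ℂ (π t) (π t) :=
      congrFun (hφ.coe_trans (chartAt ℂ (π t))) t
    have hX' : ∀ s ∈ W, CMDiffAt ω (T% X) s := fun s hs ↦
      ((hX s hs).contMDiffAt (hW.mem_nhds hs)).of_le le_self_add
    have hXt := (contMDiffAt_section_iff hz hφt X).1 (hX' t ht)
    rw [contMDiffAt_iff_comp_symm hz hφt]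
    have hf := analyticAt_localCoeff_comp_symm hU hcov hc (mem_chart_source ℂ (π t))
      (hVU (hWV ht))
    have hf' : AnalyticAt ℂ ((localCoeff cov (chartAt ℂ (π t)) ∘ π) ∘
        (φ.trans (chartAt ℂ (π t))).symm) ((φ.trans (chartAt ℂ (π t))) t) := by
      rw [hzt]
      exact hf.congr (hφ.comp_eventuallyEq hφt _).symm
    refine (hXt.deriv.add (hf'.mul hXt)).congr ?_
    have hWt : ∀ᶠ y in 𝓝 ((φ.trans (chartAt ℂ (π t))) t),
        (φ.trans (chartAt ℂ (π t))).symm y ∈ W := by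
      have := (φ.trans (chartAt ℂ (π t))).continuousAt_symm
        ((φ.trans (chartAt ℂ (π t))).map_source hφt)
      rw [ContinuousAt, (φ.trans (chartAt ℂ (π t))).left_inv hφt] at this
      exact this (hW.mem_nhds ht)
    -- The definition uses a different branch and chart at each point. Near `t` they can all be
    -- replaced by the fixed `φ` and the chart at `π t`, and the scalar is then visibly analytic.
    filter_upwards [hWt, (φ.trans (chartAt ℂ (π t))).open_target.mem_nhds
      ((φ.trans (chartAt ℂ (π t))).map_source hφt)] with y hy hy'
    have hs := (φ.trans (chartAt ℂ (π t))).map_target hy'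
    have hyy := (φ.trans (chartAt ℂ (π t))).right_inv hy'
    simp only [Function.comp_apply]
    rw [homScalar_pullbackConnection h hU hcov.isCovariantDerivativeOn hφ hc hs (hVU (hWV hy))
      (hWV hy) ((hX' _ hy).mdifferentiableAt (by simp)), pullbackScalar]
    have := congrFun (hφ.coe_trans (chartAt ℂ (π t))) ((φ.trans (chartAt ℂ (π t))).symm y)
    rw [Function.comp_apply] at this
    rw [← this, hyy]
    rfl⟩

/-- The coordinate field of `z ∘ π` has constant component `1`, so the derivative term vanishes and
only the coefficient downstairs remains. -/
lemma localCoeff_pullbackConnection (hU : IsOpen U)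
    (hcov : IsCovariantDerivativeOn (V := fun x : S ↦ TangentSpace 𝓘(ℂ, ℂ) x) ℂ cov U)
    {φ : OpenPartialHomeomorph T S} (hφ : IsBranch π φ)
    {z : OpenPartialHomeomorph S ℂ} (hz : z ∈ IsManifold.maximalAtlas 𝓘(ℂ, ℂ) ω S) {t : T}
    (htz : t ∈ (φ.trans z).source) (htU : π t ∈ U) (htV : t ∈ V) :
    localCoeff (pullbackConnection π cov V h) (φ.trans z) t = localCoeff cov z (π t) := by
  have hz' := hφ.trans_mem_maximalAtlas hz
  have hzt : (φ.trans z) t = z (π t) := congrFun (hφ.coe_trans z) t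
  have h1 := component_coordField_self_eventuallyEq hz' htz
  rw [hzt] at h1
  rw [localCoeff_eq_homScalar _ hz' htz, homScalar_pullbackConnection h hU hcov hφ hz htz htU htV
    (mdifferentiableAt_coordField hz' htz), pullbackScalar, EventuallyEq.deriv_eq h1,
    component_coordField hz' hz' htz htz, chartRatio_self htz]
  simp

lemma isGeodesicOn_pullbackConnection_iff (hU : IsOpen U) (hV : IsOpen V)
    (hcov : IsHolomorphicConnectionOn cov U) (hVU : MapsTo π V U)
    {σ : ℝ → T} {I : Set ℝ} (hI : I.OrdConnected) (hIn : I.Nontrivial)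
    (hσ : ContMDiffOn 𝓘(ℝ, ℝ) 𝓘(ℝ, ℂ) ∞ σ I) (hσV : MapsTo σ I V) :
    IsGeodesicOn (pullbackConnection π cov V h) V σ I ↔ IsGeodesicOn cov U (π ∘ σ) I := by
  have hIu := hI.uniqueDiffOn_real hIn
  -- In the chart `z ∘ π` the equation for `σ` is literally the equation for `π ∘ σ` in the chart
  -- `z`.
  have hdef : ∀ {φ : OpenPartialHomeomorph T S} {z : OpenPartialHomeomorph S ℂ},
      IsBranch π φ → z ∈ IsManifold.maximalAtlas 𝓘(ℂ, ℂ) ω S → ∀ t ∈ I,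
      σ t ∈ (φ.trans z).source →
      geodesicDefect (pullbackConnection π cov V h) (φ.trans z) σ I t =
        geodesicDefect cov z (π ∘ σ) I t := by
    intro φ z hφ hz t ht hs
    rw [geodesicDefect, geodesicDefect, localCoeff_pullbackConnection h hU
      hcov.isCovariantDerivativeOn hφ hz hs (hVU (hσV ht)) (hσV ht), hφ.coe_trans]
    rfl
  constructor
  · intro hg
    refine ⟨hI, hIn, ?_, fun t ht ↦ hVU (hσV ht), ?_⟩
    · intro t ht
      obtain ⟨φ, hφ, hφt⟩ := h (σ t) (hσV ht)
      have hc := chartAt_mem_maximalAtlas (π (σ t))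
      have hs := hφ.mem_trans_source hφt (mem_chart_source ℂ _)
      rw [contMDiffWithinAt_curve_iff hc (mem_chart_source ℂ _)]
      obtain ⟨h1, h2⟩ :=
        (contMDiffWithinAt_curve_iff (hφ.trans_mem_maximalAtlas hc) hs).1 (hσ t ht)
      refine ⟨?_, ?_⟩
      · have := φ.continuousAt hφt
        rw [hφ.coe_eq] at this
        exact this.comp_continuousWithinAt h1
      · rw [hφ.coe_trans] at h2
        exact h2
    · intro z hz t ht hx
      obtain ⟨φ, hφ, hφt⟩ := h (σ t) (hσV ht)
      have hs := hφ.mem_trans_source hφt hx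
      have h1 := hg.geodesic_eq (φ.trans z) (hφ.trans_mem_maximalAtlas hz) t ht hs
      exact (hdef hφ hz t ht hs).symm.trans h1
  · intro hg
    refine ⟨hI, hIn, hσ, hσV, ?_⟩
    intro w hw t ht hx
    obtain ⟨φ, hφ, hφt⟩ := h (σ t) (hσV ht)
    have hc := chartAt_mem_maximalAtlas (π (σ t))
    have hs := hφ.mem_trans_source hφt (mem_chart_source ℂ _)
    -- An arbitrary chart `w` of `T` need not have the form `z ∘ π`; the equation is carried over to
    -- it from such a chart.
    refine geodesic_eq_of_chart hV (isCovariantDerivativeOn_pullbackConnection h) hw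
      (hφ.trans_mem_maximalAtlas hc) hIu hσ ht (hσV ht) hx hs ?_
    rw [hdef hφ hc t ht hs]
    exact hg.geodesic_eq _ hc t ht (mem_chart_source ℂ _)

end

end PullbackConnection

/-! ### The total space of a branched covering built from combinatorial data. -/

section BranchedCover

/-- Combinatorial data for a finite branched covering of a Riemann surface, whose sheets over the
complement of `P` are indexed by a group `M`: around each point `x` a disc, the local degree, the
label of the sheet as a function of the local parameter `v`, where `v ^ deg x` is the coordinate on
the disc, the subgroup of labels permuted by the local monodromy, and a function
`transport y₀` which makes the labels locally constant near `y₀`. -/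
structure CoverData (S : Type u) [TopologicalSpace S] [ChartedSpace ℂ S] (P : Set S)
    (M : Type) [CommGroup M] where
  chart : S → OpenPartialHomeomorph S ℂ
  chart_mem : ∀ x, chart x ∈ IsManifold.maximalAtlas 𝓘(ℂ, ℂ) ω S
  target_eq : ∀ x, (chart x).target = Metric.ball 0 1
  mem_source : ∀ x, x ∈ (chart x).source
  map_center : ∀ x, chart x x = 0
  eq_of_mem : ∀ x, ∀ y ∈ (chart x).source, y ∈ P → y = x
  deg : S → ℕ
  deg_pos : ∀ x, 0 < deg x
  sheet : S → ℂ → M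
  stab : S → Subgroup M
  deg_regular : ∀ x ∉ P, deg x = 1
  stab_regular : ∀ x ∉ P, stab x = ⊥
  exists_rotation : ∀ x, ∀ g ∈ stab x, ∃ ε : ℂ, ε ^ deg x = 1 ∧
    ∀ v ∈ Metric.ball (0 : ℂ) 1, v ≠ 0 → sheet x (ε * v) = sheet x v * g
  div_mem_stab : ∀ x, ∀ v ∈ Metric.ball (0 : ℂ) 1, v ≠ 0 → ∀ v' : ℂ, v' ^ deg x = v ^ deg x →
    sheet x v' / sheet x v ∈ stab x
  sheet_injective : ∀ x, ∀ v ∈ Metric.ball (0 : ℂ) 1, v ≠ 0 → ∀ v' : ℂ, v' ^ deg x = v ^ deg x →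
    sheet x v' = sheet x v → v' = v
  transport : S → S → M
  eventually_sheet : ∀ y₀ ∉ P, ∀ x, ∀ v₀ ∈ Metric.ball (0 : ℂ) 1,
    (chart x).symm (v₀ ^ deg x) = y₀ → ∀ᶠ v in 𝓝 v₀,
      sheet x v * transport y₀ ((chart x).symm (v ^ deg x)) = sheet x v₀ * transport y₀ y₀

namespace CoverData

variable {S : Type u} [TopologicalSpace S] [ChartedSpace ℂ S] {P : Set S}
  {M : Type} [CommGroup M] (c : CoverData S P M)

/-- Two labels over the same point are identified when they differ by the local monodromy. -/
def rel : Setoid (S × M) where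
  r p q := p.1 = q.1 ∧ p.2 / q.2 ∈ c.stab p.1
  iseqv :=
    { refl := fun p ↦ ⟨rfl, by simp⟩
      symm := fun {p q} h ↦ ⟨h.1.symm, by rw [← h.1, ← inv_div]; exact inv_mem h.2⟩
      trans := fun {p q r} h h' ↦ ⟨h.1.trans h'.1, by
        rw [← div_mul_div_cancel p.2 q.2 r.2]
        exact mul_mem h.2 (h.1 ▸ h'.2)⟩ }

/-- The total space of the branched covering. -/
def Space : Type u := Quotient c.rel

/-- The point with a given label over a given point. -/
def point (x : S) (a : M) : c.Space := Quotient.mk c.rel (x, a)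

/-- The projection of the branched covering. -/
def proj : c.Space → S := Quotient.lift Prod.fst fun _ _ h ↦ h.1

@[simp] lemma proj_point (x : S) (a : M) : c.proj (c.point x a) = x := rfl

lemma point_eq_point {x y : S} {a b : M} : c.point x a = c.point y b ↔ x = y ∧ a / b ∈ c.stab x :=
  Quotient.eq (r := c.rel)

lemma exists_point (t : c.Space) : ∃ a, t = c.point (c.proj t) a := by
  induction t using Quotient.inductionOn with
  | h p => exact ⟨p.2, rfl⟩

/-- The label of a point; it is canonical away from the branch points. -/
def label (t : c.Space) : M := (c.exists_point t).choose

lemma point_label (t : c.Space) : c.point (c.proj t) (c.label t) = t := (c.exists_point t).choose_spec.symm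

/-- Away from `P` the group `stab` is trivial, so no labels are identified there. -/
lemma label_point {x : S} (hx : x ∉ P) (a : M) : c.label (c.point x a) = a := by
  have h := (c.point_eq_point.1 (c.point_label (c.point x a))).2
  rw [proj_point, c.stab_regular x hx, Subgroup.mem_bot, div_eq_one] at h
  exact h

/-- The point of the disc around `x` with parameter `v`. -/
def base (x : S) (v : ℂ) : S := (c.chart x).symm (v ^ c.deg x)

/-- The parametrization of a disc in the branched covering. -/
def param (x : S) (ξ : M) (v : ℂ) : c.Space := c.point (c.base x v) (ξ * c.sheet x v)

@[simp] lemma proj_param (x : S) (ξ : M) (v : ℂ) : c.proj (c.param x ξ v) = c.base x v := rfl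

lemma pow_mem_target (x : S) {v : ℂ} (hv : v ∈ Metric.ball (0 : ℂ) 1) :
    v ^ c.deg x ∈ (c.chart x).target := by
  rw [c.target_eq, mem_ball_zero_iff] at *
  rw [norm_pow]
  exact pow_lt_one₀ (norm_nonneg v) hv (c.deg_pos x).ne'

lemma base_mem_source (x : S) {v : ℂ} (hv : v ∈ Metric.ball (0 : ℂ) 1) :
    c.base x v ∈ (c.chart x).source := (c.chart x).map_target (c.pow_mem_target x hv)

lemma chart_base (x : S) {v : ℂ} (hv : v ∈ Metric.ball (0 : ℂ) 1) :
    c.chart x (c.base x v) = v ^ c.deg x := (c.chart x).right_inv (c.pow_mem_target x hv)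

lemma base_zero (x : S) : c.base x 0 = x := by
  rw [base, zero_pow (c.deg_pos x).ne', ← c.map_center x, (c.chart x).left_inv (c.mem_source x)]

lemma eq_zero_of_base_mem {x : S} {v : ℂ} (hv : v ∈ Metric.ball (0 : ℂ) 1)
    (h : c.base x v ∈ P) : x ∈ P ∧ v = 0 := by
  have h1 := c.eq_of_mem x _ (c.base_mem_source x hv) h
  have h2 := c.chart_base x hv
  rw [h1, c.map_center] at h2
  exact ⟨h1 ▸ h, eq_zero_of_pow_eq_zero h2.symm⟩

lemma base_regular {x : S} {v : ℂ} (hv : v ∈ Metric.ball (0 : ℂ) 1) (h0 : v ≠ 0) :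
    c.base x v ∉ P := fun h ↦ h0 (c.eq_zero_of_base_mem hv h).2

lemma pow_eq_of_base_eq {x : S} {v v' : ℂ} (hv : v ∈ Metric.ball (0 : ℂ) 1)
    (hv' : v' ∈ Metric.ball (0 : ℂ) 1) (h : c.base x v = c.base x v') :
    v ^ c.deg x = v' ^ c.deg x := by
  rw [← c.chart_base x hv, h, c.chart_base x hv']

lemma param_eq_regular {x x' : S} {ξ ξ' : M} {v v' : ℂ} (h : c.param x ξ v = c.param x' ξ' v')
    (hr : c.base x v ∉ P) : ξ * c.sheet x v = ξ' * c.sheet x' v' := by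
  have := (c.point_eq_point.1 h).2
  rwa [c.stab_regular _ hr, Subgroup.mem_bot, div_eq_one] at this

/-- Two parameters over the same point have equal `deg`-th powers, and then `sheet` tells them
apart; at the centre the power alone suffices. -/
lemma injOn_param (x : S) (ξ : M) : InjOn (c.param x ξ) (Metric.ball 0 1) := by
  intro v hv v' hv' h
  have hp := c.pow_eq_of_base_eq hv hv' (c.point_eq_point.1 h).1
  by_cases h0 : v' = 0
  · rw [h0, zero_pow (c.deg_pos x).ne'] at hp
    rw [h0, eq_zero_of_pow_eq_zero hp]
  · refine c.sheet_injective x v' hv' h0 v hp ?_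
    have hr : c.base x v ∉ P := by
      rw [(c.point_eq_point.1 h).1]; exact c.base_regular hv' h0
    exact mul_left_cancel (c.param_eq_regular h hr)

/-- The disc charts of the branched covering, before it carries a topology. -/
def discEquiv (x : S) (ξ : M) : PartialEquiv c.Space ℂ :=
  ((c.injOn_param x ξ).toPartialEquiv (c.param x ξ) (Metric.ball 0 1)).symm

@[simp] lemma discEquiv_source (x : S) (ξ : M) :
    (c.discEquiv x ξ).source = c.param x ξ '' Metric.ball 0 1 := rfl

@[simp] lemma discEquiv_target (x : S) (ξ : M) :
    (c.discEquiv x ξ).target = Metric.ball 0 1 := rfl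

@[simp] lemma discEquiv_symm (x : S) (ξ : M) : ⇑(c.discEquiv x ξ).symm = c.param x ξ := rfl

lemma discEquiv_param (x : S) (ξ : M) {v : ℂ} (hv : v ∈ Metric.ball (0 : ℂ) 1) :
    c.discEquiv x ξ (c.param x ξ v) = v :=
  (c.discEquiv x ξ).right_inv (by simpa using hv)

/-- A local analytic root. -/
lemma exists_analyticAt_root {m : ℕ} {v₀ : ℂ} (hm : 0 < m) (h : m = 1 ∨ v₀ ≠ 0) :
    ∃ s : ℂ → ℂ, AnalyticAt ℂ s (v₀ ^ m) ∧ s (v₀ ^ m) = v₀ ∧ ∀ y, s y ^ m = y := by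
  by_cases h1 : m = 1
  · subst h1
    exact ⟨id, analyticAt_id, by simp, by simp⟩
  · have h0 : v₀ ≠ 0 := by tauto
    have hp : v₀ ^ m ≠ 0 := pow_ne_zero _ h0
    -- Dividing by `v₀ ^ m` moves the base point to `1`, away from the cut of the principal power.
    refine ⟨fun y ↦ v₀ * (y / v₀ ^ m) ^ ((m : ℂ)⁻¹), ?_, ?_, ?_⟩
    · refine analyticAt_const.mul (AnalyticAt.cpow (analyticAt_id.div analyticAt_const hp)
        analyticAt_const ?_)
      simp [div_self hp]
    · simp [div_self hp]
    · intro y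
      rw [mul_pow, Complex.cpow_nat_inv_pow _ hm.ne', mul_div_cancel₀ _ hp]

variable [IsManifold 𝓘(ℂ, ℂ) ω S]

/-- Change of disc charts. -/
lemma exists_analyticAt_change {x x' : S} {ξ ξ' : M} {v₀ v₀' : ℂ}
    (hv₀ : v₀ ∈ Metric.ball (0 : ℂ) 1) (hv₀' : v₀' ∈ Metric.ball (0 : ℂ) 1)
    (h : c.param x ξ v₀ = c.param x' ξ' v₀') :
    ∃ g : ℂ → ℂ, AnalyticAt ℂ g v₀ ∧ g v₀ = v₀' ∧
      ∀ᶠ v in 𝓝 v₀, v ∈ Metric.ball (0 : ℂ) 1 ∧ g v ∈ Metric.ball (0 : ℂ) 1 ∧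
        c.param x' ξ' (g v) = c.param x ξ v := by
  have hball : ∀ᶠ v in 𝓝 v₀, v ∈ Metric.ball (0 : ℂ) 1 := Metric.isOpen_ball.mem_nhds hv₀
  have hbase : c.base x v₀ = c.base x' v₀' := (c.point_eq_point.1 h).1
  by_cases hr : c.base x v₀ ∈ P
  · obtain ⟨hxP, rfl⟩ := c.eq_zero_of_base_mem hv₀ hr
    obtain ⟨-, rfl⟩ := c.eq_zero_of_base_mem hv₀' (hbase ▸ hr)
    rw [c.base_zero, c.base_zero] at hbase
    subst hbase
    have hg := (c.point_eq_point.1 h).2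
    rw [mul_div_mul_right_eq_div, c.base_zero] at hg
    -- At a branch point both discs have the same centre, and their labels differ by an element of
    -- the local monodromy. The change of charts is the rotation realizing that element.
    obtain ⟨ε, hε, hrot⟩ := c.exists_rotation x _ hg
    have hε1 : ‖ε‖ = 1 := by
      have := congrArg norm hε
      rw [norm_pow, norm_one] at this
      exact (pow_eq_one_iff_of_nonneg (norm_nonneg _) (c.deg_pos x).ne').1 this
    refine ⟨fun v ↦ ε * v, analyticAt_const.mul analyticAt_id, by simp, ?_⟩
    filter_upwards [hball] with v hv
    refine ⟨hv, by simpa [hε1] using hv, ?_⟩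
    by_cases h0 : v = 0
    · simpa [h0] using h.symm
    · rw [param, param, hrot v hv h0, c.point_eq_point, base, mul_pow, hε, one_mul]
      refine ⟨rfl, ?_⟩
      rw [mul_comm (c.sheet x v), ← mul_assoc, mul_div_cancel, div_self']
      exact one_mem _
  -- Over a regular point the second parameter is either unramified or nonzero, so a local analytic
  -- `deg`-th root exists. The change of charts is that root of the coordinate around `x'`.
  · have hcond : c.deg x' = 1 ∨ v₀' ≠ 0 := by
      by_cases hx' : x' ∈ P
      · right
        rintro rfl
        rw [hbase, c.base_zero] at hr
        exact hr hx'
      · exact Or.inl (c.deg_regular x' hx')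
    obtain ⟨s, hs, hs0, hspow⟩ := exists_analyticAt_root (c.deg_pos x') hcond
    have hmem' : c.base x v₀ ∈ (c.chart x').source := by
      rw [hbase]; exact c.base_mem_source x' hv₀'
    have hval : c.chart x' (c.base x v₀) = v₀' ^ c.deg x' := by
      rw [hbase, c.chart_base x' hv₀']
    have htr := analyticAt_transition (c.chart_mem x') (c.chart_mem x) hmem'
      (c.base_mem_source x hv₀)
    rw [c.chart_base x hv₀] at htr
    have hpow : AnalyticAt ℂ (fun v : ℂ ↦ v ^ c.deg x) v₀ := analyticAt_id.pow _
    have hinner : AnalyticAt ℂ (fun v ↦ c.chart x' (c.base x v)) v₀ :=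
      AnalyticAt.fun_comp (f := fun v : ℂ ↦ v ^ c.deg x) htr hpow
    have hg : AnalyticAt ℂ (fun v ↦ s (c.chart x' (c.base x v))) v₀ := by
      refine AnalyticAt.fun_comp (f := fun v ↦ c.chart x' (c.base x v)) ?_ hinner
      rw [hval]; exact hs
    have hg0 : s (c.chart x' (c.base x v₀)) = v₀' := by rw [hval, hs0]
    have htend : Tendsto (fun v ↦ s (c.chart x' (c.base x v))) (𝓝 v₀) (𝓝 v₀') := by
      have := hg.continuousAt.tendsto
      rwa [hg0] at this
    refine ⟨_, hg, hg0, ?_⟩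
    have hsrc : ∀ᶠ v in 𝓝 v₀, c.base x v ∈ (c.chart x').source := by
      have h1 : ContinuousAt (c.base x) v₀ := by
        refine ContinuousAt.comp' (f := fun v : ℂ ↦ v ^ c.deg x) ?_ hpow.continuousAt
        exact (c.chart x).continuousAt_symm (c.pow_mem_target x hv₀)
      exact h1 ((c.chart x').open_source.mem_nhds hmem')
    have hl := c.eventually_sheet (c.base x v₀) hr x v₀ hv₀ rfl
    have hl' := htend.eventually (c.eventually_sheet (c.base x v₀) hr x' v₀' hv₀' hbase.symm)
    filter_upwards [hball, htend.eventually (Metric.isOpen_ball.mem_nhds hv₀'), hsrc, hl, hl']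
      with v hv hgv hsv h1 h2
    refine ⟨hv, hgv, ?_⟩
    have hb : c.base x' (s (c.chart x' (c.base x v))) = c.base x v := by
      rw [base, hspow, (c.chart x').left_inv hsv]
    have hb' : (c.chart x').symm (s (c.chart x' (c.base x v)) ^ c.deg x') =
      (c.chart x).symm (v ^ c.deg x) := hb
    rw [hb'] at h2
    -- The transported labels of both discs are locally constant and agree at the base point, hence
    -- nearby; cancelling the common transport gives equality of labels.
    have h3 := c.param_eq_regular h hr
    have h4 : ξ' * c.sheet x' (s (c.chart x' (c.base x v))) = ξ * c.sheet x v := by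
      refine mul_right_cancel (b := c.transport (c.base x v₀) ((c.chart x).symm (v ^ c.deg x))) ?_
      rw [mul_assoc, h2, mul_assoc, h1, ← mul_assoc, ← mul_assoc, h3]
    rw [param, param, hb, h4]

/-- The atlas of disc charts. -/
def core : ChartedSpaceCore ℂ c.Space where
  atlas := {e | ∃ (x : S) (ξ : M), e = c.discEquiv x ξ}
  -- Dividing by the value of `sheet` at `0` puts `t` at the centre of its disc, whatever that value
  -- is.
  chartAt t := c.discEquiv (c.proj t) (c.label t / c.sheet (c.proj t) 0)
  mem_chart_source t := by
    refine ⟨0, by simp, ?_⟩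
    rw [param, c.base_zero, div_mul_cancel, c.point_label]
  chart_mem_atlas t := ⟨_, _, rfl⟩
  open_source := by
    rintro _ _ ⟨x, ξ, rfl⟩ ⟨x', ξ', rfl⟩
    rw [isOpen_iff_mem_nhds]
    rintro v ⟨hv, v', hv', h⟩
    obtain ⟨g, -, -, hev⟩ := c.exists_analyticAt_change hv hv' h.symm
    filter_upwards [hev] with w hw
    exact ⟨hw.1, g w, hw.2.1, hw.2.2⟩
  continuousOn_toFun := by
    rintro _ _ ⟨x, ξ, rfl⟩ ⟨x', ξ', rfl⟩ v ⟨hv, v', hv', h⟩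
    obtain ⟨g, hg, -, hev⟩ := c.exists_analyticAt_change hv hv' h.symm
    refine (hg.continuousAt.congr ?_).continuousWithinAt
    filter_upwards [hev] with w hw
    change g w = c.discEquiv x' ξ' (c.param x ξ w)
    rw [← hw.2.2, c.discEquiv_param x' ξ' hw.2.1]

instance : TopologicalSpace c.Space := c.core.toTopologicalSpace

instance : ChartedSpace ℂ c.Space := c.core.toChartedSpace

/-- The disc charts of the branched covering. -/
def disc (x : S) (ξ : M) : OpenPartialHomeomorph c.Space ℂ :=
  c.core.openPartialHomeomorph (c.discEquiv x ξ) ⟨x, ξ, rfl⟩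

@[simp] lemma disc_source (x : S) (ξ : M) :
    (c.disc x ξ).source = c.param x ξ '' Metric.ball 0 1 := rfl

@[simp] lemma disc_target (x : S) (ξ : M) : (c.disc x ξ).target = Metric.ball 0 1 := rfl

@[simp] lemma disc_symm (x : S) (ξ : M) : ⇑(c.disc x ξ).symm = c.param x ξ := rfl

lemma disc_param (x : S) (ξ : M) {v : ℂ} (hv : v ∈ Metric.ball (0 : ℂ) 1) :
    c.disc x ξ (c.param x ξ v) = v := c.discEquiv_param x ξ hv

lemma disc_mem_atlas (x : S) (ξ : M) : c.disc x ξ ∈ atlas ℂ c.Space := by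
  change _ ∈ ⋃ (e : PartialEquiv c.Space ℂ) (he : e ∈ c.core.atlas),
    {c.core.openPartialHomeomorph e he}
  simp only [mem_iUnion, mem_singleton_iff]
  exact ⟨_, ⟨x, ξ, rfl⟩, rfl⟩

lemma exists_eq_disc {e : OpenPartialHomeomorph c.Space ℂ} (he : e ∈ atlas ℂ c.Space) :
    ∃ x ξ, e = c.disc x ξ := by
  change _ ∈ ⋃ (e : PartialEquiv c.Space ℂ) (he : e ∈ c.core.atlas),
    {c.core.openPartialHomeomorph e he} at he
  simp only [mem_iUnion, mem_singleton_iff] at he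
  obtain ⟨_, ⟨x, ξ, rfl⟩, rfl⟩ := he
  exact ⟨x, ξ, rfl⟩

instance : IsManifold 𝓘(ℂ, ℂ) ω c.Space := by
  refine isManifold_of_contDiffOn _ _ _ fun e e' he he' ↦ ?_
  obtain ⟨x, ξ, rfl⟩ := c.exists_eq_disc he
  obtain ⟨x', ξ', rfl⟩ := c.exists_eq_disc he'
  simp only [mfld_simps]
  rintro v ⟨hv, v', hv', h⟩
  obtain ⟨g, hg, -, hev⟩ := c.exists_analyticAt_change hv hv' h.symm
  refine (hg.contDiffAt.congr_of_eventuallyEq ?_).contDiffWithinAt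
  filter_upwards [hev] with w hw
  change c.disc x' ξ' (c.param x ξ w) = g w
  rw [← hw.2.2, c.disc_param x' ξ' hw.2.1]

lemma exists_param_eq (x : S) {t : c.Space} (ht : c.proj t ∈ (c.chart x).source) :
    ∃ ξ v, v ∈ Metric.ball (0 : ℂ) 1 ∧ t = c.param x ξ v ∧ v ^ c.deg x = c.chart x (c.proj t) := by
  obtain ⟨v, hv⟩ := IsAlgClosed.exists_pow_nat_eq (c.chart x (c.proj t)) (c.deg_pos x)
  refine ⟨c.label t / c.sheet x v, v, ?_, ?_, hv⟩
  · have := (c.chart x).map_source ht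
    rw [c.target_eq, mem_ball_zero_iff, ← hv, norm_pow] at this
    rw [mem_ball_zero_iff]
    by_contra hcon
    exact absurd this (not_lt.2 (one_le_pow₀ (not_lt.1 hcon)))
  · rw [param, div_mul_cancel, base, hv, (c.chart x).left_inv ht, c.point_label]

lemma mem_disc_source (x : S) {t : c.Space} (ht : c.proj t ∈ (c.chart x).source) :
    ∃ ξ, t ∈ (c.disc x ξ).source := by
  obtain ⟨ξ, v, hv, h, -⟩ := c.exists_param_eq x ht
  exact ⟨ξ, v, hv, h.symm⟩

lemma proj_eq_on_disc (x : S) (ξ : M) {t : c.Space} (ht : t ∈ (c.disc x ξ).source) :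
    c.proj t = c.base x (c.disc x ξ t) := by
  obtain ⟨v, hv, rfl⟩ := ht
  rw [c.disc_param x ξ hv, c.proj_param]

lemma contMDiff_proj : ContMDiff 𝓘(ℂ, ℂ) 𝓘(ℂ, ℂ) ω c.proj := by
  intro t
  obtain ⟨ξ, hξ⟩ := c.mem_disc_source _ (c.mem_source (c.proj t))
  have hd := (c.disc (c.proj t) ξ).map_source hξ
  have h1 : ContMDiffAt 𝓘(ℂ, ℂ) 𝓘(ℂ, ℂ) ω (c.disc (c.proj t) ξ) t :=
    contMDiffAt_of_mem_maximalAtlas (IsManifold.subset_maximalAtlas (c.disc_mem_atlas _ ξ)) hξ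
  have h2 : ContMDiffAt 𝓘(ℂ, ℂ) 𝓘(ℂ, ℂ) ω (fun v : ℂ ↦ v ^ c.deg (c.proj t))
      (c.disc (c.proj t) ξ t) := (contDiff_id.pow _).contDiffAt.contMDiffAt
  have h3 := contMDiffAt_symm_of_mem_maximalAtlas (c.chart_mem (c.proj t))
    (c.pow_mem_target (c.proj t) hd)
  refine ((h3.comp (c.disc (c.proj t) ξ t) h2).comp t h1).congr_of_eventuallyEq ?_
  filter_upwards [(c.disc (c.proj t) ξ).open_source.mem_nhds hξ] with s hs
  exact c.proj_eq_on_disc _ ξ hs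

lemma continuous_proj : Continuous c.proj := c.contMDiff_proj.continuous

lemma isOpenMap_proj : IsOpenMap c.proj := by
  rw [isOpenMap_iff_nhds_le]
  intro t
  obtain ⟨ξ, hξ⟩ := c.mem_disc_source _ (c.mem_source (c.proj t))
  set x := c.proj t with hx
  have hd := (c.disc x ξ).map_source hξ
  have hev : c.proj =ᶠ[𝓝 t] fun s ↦ (c.chart x).symm ((c.disc x ξ s) ^ c.deg x) := by
    filter_upwards [(c.disc x ξ).open_source.mem_nhds hξ] with s hs
    exact c.proj_eq_on_disc _ ξ hs
  have h1 : map (c.disc x ξ) (𝓝 t) = 𝓝 (c.disc x ξ t) := (c.disc x ξ).map_nhds_eq hξ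
  have h2 : 𝓝 ((c.disc x ξ t) ^ c.deg x) ≤ map (fun v : ℂ ↦ v ^ c.deg x) (𝓝 (c.disc x ξ t)) := by
    have han : AnalyticAt ℂ (fun v : ℂ ↦ v ^ c.deg x) (c.disc x ξ t) := analyticAt_id.pow _
    -- The open mapping theorem applies to the power map, which is not locally constant because a
    -- number has only finitely many roots.
    refine han.eventually_constant_or_nhds_le_map_nhds.resolve_left fun hcon ↦ ?_
    have hfin : {v : ℂ | v ^ c.deg x = (c.disc x ξ t) ^ c.deg x}.Finite := by
      have := (Polynomial.nthRoots (c.deg x) ((c.disc x ξ t) ^ c.deg x)).toFinset.finite_toSet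
      refine this.subset fun v hv ↦ ?_
      simpa [Polynomial.mem_nthRoots (c.deg_pos x)] using hv
    exact (infinite_of_mem_nhds _ hcon) hfin
  have h3 : map (c.chart x).symm (𝓝 ((c.disc x ξ t) ^ c.deg x)) =
      𝓝 ((c.chart x).symm ((c.disc x ξ t) ^ c.deg x)) :=
    (c.chart x).symm.map_nhds_eq (c.pow_mem_target x hd)
  rw [map_congr hev]
  have h4 : (fun s ↦ (c.chart x).symm ((c.disc x ξ s) ^ c.deg x)) =
    (c.chart x).symm ∘ (fun v : ℂ ↦ v ^ c.deg x) ∘ (c.disc x ξ) := rfl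
  rw [h4, ← Filter.map_map, ← Filter.map_map, h1]
  have h5 := map_mono (m := (c.chart x).symm) h2
  rw [h3] at h5
  exact le_trans (le_of_eq (congrArg 𝓝 hev.self_of_nhds)) h5

lemma finite_fiber [Finite M] (x : S) : (c.proj ⁻¹' {x}).Finite := by
  refine (Set.finite_range (c.point x)).subset ?_
  rintro t rfl
  exact ⟨c.label t, c.point_label t⟩

instance [T2Space S] : T2Space c.Space := by
  refine ⟨fun t t' hne ↦ ?_⟩
  by_cases hp : c.proj t = c.proj t'
  · obtain ⟨ξ, v, hv, h, hpow⟩ := c.exists_param_eq (c.proj t) (c.mem_source (c.proj t))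
    obtain ⟨ξ', v', hv', h', hpow'⟩ := c.exists_param_eq (c.proj t) (t := t')
      (hp ▸ c.mem_source (c.proj t))
    rw [c.map_center] at hpow
    rw [← hp, c.map_center] at hpow'
    obtain rfl := eq_zero_of_pow_eq_zero hpow
    obtain rfl := eq_zero_of_pow_eq_zero hpow'
    refine ⟨(c.disc (c.proj t) ξ).source, (c.disc (c.proj t) ξ').source,
      (c.disc _ ξ).open_source, (c.disc _ ξ').open_source, ⟨0, hv, h.symm⟩, ⟨0, hv', h'.symm⟩, ?_⟩
    rw [Set.disjoint_left]
    rintro _ ⟨w, hw, rfl⟩ ⟨w', hw', hww⟩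
    have hpw := c.pow_eq_of_base_eq hw' hw (c.point_eq_point.1 hww).1
    apply hne
    -- If the two discs centred over the same point met, their labels would differ by the local
    -- monodromy and their centres would be identified.
    have hstab : ξ / ξ' ∈ c.stab (c.proj t) := by
      by_cases h0 : w = 0
      · subst h0
        rw [zero_pow (c.deg_pos _).ne'] at hpw
        obtain rfl := eq_zero_of_pow_eq_zero hpw
        have := (c.point_eq_point.1 hww.symm).2
        rwa [mul_div_mul_right_eq_div, c.base_zero] at this
      · have h1 := c.div_mem_stab (c.proj t) w hw h0 w' hpw
        have h2 := c.param_eq_regular hww.symm (c.base_regular hw h0)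
        have : ξ / ξ' = c.sheet (c.proj t) w' / c.sheet (c.proj t) w := by
          rw [div_eq_div_iff_mul_eq_mul, h2, mul_comm]
        rwa [this]
    rw [h, h', param, param, c.point_eq_point, mul_div_mul_right_eq_div, c.base_zero]
    exact ⟨rfl, hstab⟩
  · exact separated_by_continuous c.continuous_proj hp

instance [CompactSpace S] [Finite M] : CompactSpace c.Space := by
  let K : S → Set c.Space := fun x ↦ ⋃ ξ : M, c.param x ξ '' Metric.closedBall 0 (1 / 2)
  have hK : ∀ x, IsCompact (K x) := by
    refine fun x ↦ isCompact_iUnion fun ξ ↦ ?_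
    refine (isCompact_closedBall _ _).image_of_continuousOn ?_
    rw [← c.disc_symm]
    refine (c.disc x ξ).continuousOn_symm.mono ?_
    rw [disc_target]
    exact Metric.closedBall_subset_ball (by norm_num)
  -- The radius `(1 / 2) ^ deg x` ensures that every parameter over `W x` has norm less than `1 /
  -- 2`. The finitely many compact half-discs then contain the whole preimage of `W x`.
  let W : S → Set S := fun x ↦ (c.chart x).source ∩
    c.chart x ⁻¹' Metric.ball 0 ((1 / 2) ^ c.deg x)
  have hW : ∀ x, W x ∈ 𝓝 x := by
    intro x
    refine ((c.chart x).isOpen_inter_preimage Metric.isOpen_ball).mem_nhds ⟨c.mem_source x, ?_⟩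
    rw [mem_preimage, c.map_center]
    exact Metric.mem_ball_self (by positivity)
  have hWK : ∀ x t, c.proj t ∈ W x → t ∈ K x := by
    intro x t ht
    obtain ⟨ξ, v, hv, h, hpow⟩ := c.exists_param_eq x ht.1
    refine mem_iUnion.2 ⟨ξ, v, ?_, h.symm⟩
    have := ht.2
    rw [mem_preimage, mem_ball_zero_iff, ← hpow, norm_pow] at this
    rw [mem_closedBall_zero_iff]
    exact (lt_of_pow_lt_pow_left₀ _ (by norm_num) this).le
  obtain ⟨F, -, hF⟩ := (isCompact_univ (X := S)).elim_nhds_subcover W fun x _ ↦ hW x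
  refine ⟨(F.isCompact_biUnion fun x _ ↦ hK x).of_isClosed_subset isClosed_univ ?_⟩
  intro t _
  obtain ⟨x, hx, h⟩ := mem_iUnion₂.1 (hF (mem_univ (c.proj t)))
  exact mem_iUnion₂.2 ⟨x, hx, hWK x t h⟩

/-- Near a regular point the transported label is locally constant. -/
lemma eventually_label (t₀ : c.Space) (ht₀ : c.proj t₀ ∉ P) : ∀ᶠ t in 𝓝 t₀,
    c.label t * c.transport (c.proj t₀) (c.proj t) =
      c.label t₀ * c.transport (c.proj t₀) (c.proj t₀) := by
  obtain ⟨ξ, hξ⟩ := c.mem_disc_source _ (c.mem_source (c.proj t₀))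
  have hd := (c.disc (c.proj t₀) ξ).map_source hξ
  have hlab : ∀ t ∈ (c.disc (c.proj t₀) ξ).source,
      c.label t = ξ * c.sheet (c.proj t₀) (c.disc (c.proj t₀) ξ t) := by
    rintro _ ⟨v, hv, rfl⟩
    rw [c.disc_param _ _ hv, param, c.label_point]
    exact fun h ↦ ht₀ (c.eq_zero_of_base_mem hv h).1
  have h1 := (c.disc (c.proj t₀) ξ).continuousAt hξ |>.eventually
    (c.eventually_sheet (c.proj t₀) ht₀ (c.proj t₀) _ hd (c.proj_eq_on_disc _ ξ hξ).symm)
  filter_upwards [h1, (c.disc (c.proj t₀) ξ).open_source.mem_nhds hξ] with t ht hts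
  rw [hlab t hts, hlab t₀ hξ, mul_assoc, mul_assoc, ← ht]
  congr 3
  exact c.proj_eq_on_disc _ ξ hts

end CoverData

end BranchedCover

/-! ### A connected component of the branched covering. -/

section ConnectedCover

variable {S : Type u} [TopologicalSpace S] [ChartedSpace ℂ S] [IsManifold 𝓘(ℂ, ℂ) ω S]

/-- When `π` is the identity in the coordinates `e` and `z`, the composite `z⁻¹ ∘ e` is a partial
biholomorphism agreeing with `π` on its source. Its underlying function is then replaced by `π`. -/
lemma exists_isBranch_of_chart {T : Type*} [TopologicalSpace T] [ChartedSpace ℂ T]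
    [IsManifold 𝓘(ℂ, ℂ) ω T] {π : T → S} {e : OpenPartialHomeomorph T ℂ}
    (he : e ∈ IsManifold.maximalAtlas 𝓘(ℂ, ℂ) ω T) {z : OpenPartialHomeomorph S ℂ}
    (hz : z ∈ IsManifold.maximalAtlas 𝓘(ℂ, ℂ) ω S)
    (h : ∀ s ∈ e.source, π s ∈ z.source ∧ z (π s) = e s) :
    ∃ φ : OpenPartialHomeomorph T S, IsBranch π φ ∧ φ.source = e.source := by
  have hsrc : (e.trans z.symm).source = e.source := by
    rw [OpenPartialHomeomorph.trans_source, inter_eq_left]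
    intro s hs
    rw [mem_preimage, ← (h s hs).2]
    exact z.map_source (h s hs).1
  have heq : EqOn π (e.trans z.symm) e.source := by
    intro s hs
    rw [OpenPartialHomeomorph.coe_trans, Function.comp_apply, ← (h s hs).2,
      z.left_inv (h s hs).1]
  refine ⟨{ (e.trans z.symm) with
    toFun := π
    map_source' := fun s hs ↦ ?_
    left_inv' := fun s hs ↦ ?_
    right_inv' := fun y hy ↦ ?_
    continuousOn_toFun := ?_ }, ⟨rfl, ?_, ?_⟩, hsrc⟩
  · rw [heq (hsrc ▸ hs)]
    exact (e.trans z.symm).map_source hs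
  · rw [heq (hsrc ▸ hs)]
    exact (e.trans z.symm).left_inv hs
  · rw [heq (hsrc ▸ (e.trans z.symm).map_target hy)]
    exact (e.trans z.symm).right_inv hy
  · exact (e.trans z.symm).continuousOn.congr (by rw [hsrc]; exact heq)
  · refine ContMDiffOn.congr (f := z.symm ∘ e) ?_ (by intro s hs; exact heq (hsrc ▸ hs))
    refine (contMDiffOn_symm_of_mem_maximalAtlas hz).comp
      ((contMDiffOn_of_mem_maximalAtlas he).mono hsrc.le) ?_
    intro s hs
    rw [mem_preimage, ← (h s (hsrc ▸ hs)).2]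
    exact z.map_source (h s (hsrc ▸ hs)).1
  · refine ContMDiffOn.congr (f := e.symm ∘ z) ?_ (fun _ _ ↦ rfl)
    have htgt : (e.trans z.symm).target ⊆ z.source ∩ z ⁻¹' e.target := by
      rw [OpenPartialHomeomorph.trans_target]; exact le_rfl
    exact (contMDiffOn_symm_of_mem_maximalAtlas he).comp
      ((contMDiffOn_of_mem_maximalAtlas hz).mono fun y hy ↦ (htgt hy).1) fun y hy ↦ (htgt hy).2

theorem CoverData.exists_connected_cover [T2Space S] [CompactSpace S] [ConnectedSpace S]
    {P : Set S} {M : Type} [CommGroup M] [Finite M] (c : CoverData S P M) :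
    ∃ (T : Type u) (_ : TopologicalSpace T) (_ : ChartedSpace ℂ T)
      (_ : IsManifold 𝓘(ℂ, ℂ) ω T) (_ : T2Space T)
      (_ : CompactSpace T) (_ : ConnectedSpace T) (π : T → S) (label : T → M),
      IsRamifiedCovering π P ∧
      (∀ t ∈ (π ⁻¹' P)ᶜ, ∃ φ : OpenPartialHomeomorph T S, IsBranch π φ ∧ t ∈ φ.source) ∧
      ∀ t₀ ∈ (π ⁻¹' P)ᶜ, ∀ᶠ t in 𝓝 t₀,
        label t * c.transport (π t₀) (π t) = label t₀ * c.transport (π t₀) (π t₀) := by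
  have : LocallyConnectedSpace c.Space := ChartedSpace.locallyConnectedSpace ℂ c.Space
  obtain ⟨x₀⟩ := (inferInstance : Nonempty S)
  -- The total space may be disconnected, namely when the monodromy does not reach all labels; any
  -- one component will do.
  let t₀ : c.Space := c.point x₀ 1
  let C : TopologicalSpace.Opens c.Space := ⟨connectedComponent t₀, isOpen_connectedComponent⟩
  have hCc : IsClosed (C : Set c.Space) := isClosed_connectedComponent
  have hcompact : CompactSpace C := isCompact_iff_compactSpace.1 hCc.isCompact
  have hconn : ConnectedSpace C := isConnected_iff_connectedSpace.1 isConnected_connectedComponent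
  have hCne : Nonempty C := ⟨⟨t₀, mem_connectedComponent⟩⟩
  have hhol : ContMDiff 𝓘(ℂ, ℂ) 𝓘(ℂ, ℂ) ω (fun t : C ↦ c.proj t) :=
    c.contMDiff_proj.comp contMDiff_subtype_val
  have hbranch : ∀ t ∈ ((fun t : C ↦ c.proj t) ⁻¹' P)ᶜ, ∃ φ : OpenPartialHomeomorph C S,
      IsBranch (fun t : C ↦ c.proj t) φ ∧ t ∈ φ.source := by
    intro t ht
    obtain ⟨ξ, hξ⟩ := c.mem_disc_source _ (c.mem_source (c.proj t))
    have he : (c.disc (c.proj t) ξ).subtypeRestr hCne ∈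
        IsManifold.maximalAtlas 𝓘(ℂ, ℂ) ω C :=
      StructureGroupoid.subtypeRestr_mem_maximalAtlas (c.disc_mem_atlas _ ξ) hCne
    obtain ⟨φ, hφ, hs⟩ := exists_isBranch_of_chart (π := fun t : C ↦ c.proj t) he
      (c.chart_mem (c.proj t)) (by
        intro s hs
        rw [OpenPartialHomeomorph.subtypeRestr_source] at hs
        have hd := (c.disc (c.proj t) ξ).map_source hs
        have hp := c.proj_eq_on_disc _ ξ hs
        refine ⟨?_, ?_⟩
        · simp only [hp]
          exact c.base_mem_source _ hd
        · simp only [hp]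
          rw [c.chart_base _ hd, c.deg_regular _ ht, pow_one]
          rfl)
    refine ⟨φ, hφ, ?_⟩
    rw [hs, OpenPartialHomeomorph.subtypeRestr_source]
    exact hξ
  refine ⟨C, inferInstance, inferInstance, inferInstance, inferInstance, hcompact, hconn,
    fun t ↦ c.proj t, fun t ↦ c.label t, ⟨hhol, ?_, ?_, ?_⟩, hbranch, ?_⟩
  -- The image of the component is closed by compactness and open by the open mapping property,
  -- hence all of the connected surface `S`.
  · have hclosed : IsClosed (range fun t : C ↦ c.proj t) :=
      (isCompact_range hhol.continuous).isClosed
    have hopen : IsOpen (range fun t : C ↦ c.proj t) :=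
      (c.isOpenMap_proj.comp C.isOpen.isOpenMap_subtype_val).isOpen_range
    exact range_eq_univ.1 (IsClopen.eq_univ ⟨hclosed, hopen⟩ (range_nonempty _))
  · intro x
    exact (c.finite_fiber x).preimage (f := (Subtype.val : C → c.Space)) Subtype.val_injective.injOn
  -- The component is compact and Hausdorff, so a local homeomorphism over `Pᶜ` is automatically a
  -- covering there.
  · refine IsCoveringMapOn.of_isLocalHomeomorphOn hhol.continuous fun t ht ↦ ?_
    obtain ⟨φ, hφ, hs⟩ := hbranch t ht
    exact ⟨φ, hs, hφ.coe_eq.symm⟩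
  · intro t ht
    exact continuous_subtype_val.continuousAt.eventually (c.eventually_label t ht)

end ConnectedCover

/-! ### Roots of circle-valued functions on the punctured disc. -/

section PuncturedDisc

/-- A universal covering of the punctured unit disc by the plane. -/
def expDisc (w : ℂ) : ℂ := Complex.exp (-Real.exp w.re + w.im * Complex.I)

/-- The real part of the logarithm is `-exp (re w)`, which ranges over the negative reals, so the
whole plane serves as the covering space. -/
lemma norm_expDisc (w : ℂ) : ‖expDisc w‖ = Real.exp (-Real.exp w.re) := by
  rw [expDisc, Complex.norm_exp]
  simp [Complex.exp_ofReal_re]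

lemma expDisc_ne_zero (w : ℂ) : expDisc w ≠ 0 := Complex.exp_ne_zero _

lemma expDisc_mem_ball (w : ℂ) : expDisc w ∈ Metric.ball (0 : ℂ) 1 := by
  rw [mem_ball_zero_iff, norm_expDisc, Real.exp_lt_one_iff]
  simpa using Real.exp_pos _

lemma continuous_expDisc : Continuous expDisc := by
  unfold expDisc
  fun_prop

lemma expDisc_add_mul_I (w : ℂ) (θ : ℝ) :
    expDisc (w + θ * Complex.I) = Complex.exp (θ * Complex.I) * expDisc w := by
  rw [expDisc, expDisc, ← Complex.exp_add]
  congr 1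
  simp
  ring

lemma expDisc_eq_iff {w w' : ℂ} (h : expDisc w = expDisc w') :
    ∃ n : ℤ, w = w' + (n * (2 * Real.pi) : ℝ) * Complex.I := by
  have hn := congrArg norm h
  rw [norm_expDisc, norm_expDisc, Real.exp_eq_exp, neg_inj, Real.exp_eq_exp] at hn
  obtain ⟨n, hn'⟩ := Complex.exp_eq_exp_iff_exists_int.1 h
  refine ⟨n, Complex.ext (by simp [hn]) ?_⟩
  have := congrArg Complex.im hn'
  simpa using this

/-- The map covering the power map of the punctured disc. -/
def powLift (m : ℕ) (w : ℂ) : ℂ := (w.re + Real.log m : ℝ) + (m * w.im : ℝ) * Complex.I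

lemma continuous_powLift (m : ℕ) : Continuous (powLift m) := by
  unfold powLift
  fun_prop

/-- Taking `m`-th powers multiplies `log ‖v‖` by `m`, which in this parametrization adds `log m` to
the real part. -/
lemma expDisc_powLift {m : ℕ} (hm : 0 < m) (w : ℂ) : expDisc (powLift m w) = expDisc w ^ m := by
  have hm' : (0 : ℝ) < m := by exact_mod_cast hm
  have hre : Real.exp (powLift m w).re = Real.exp w.re * m := by
    have h : (powLift m w).re = w.re + Real.log m := by
      rw [powLift, Complex.add_re, Complex.ofReal_re, Complex.re_ofReal_mul]; simp
    rw [h, Real.exp_add, Real.exp_log hm']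
  have him : (powLift m w).im = m * w.im := by
    rw [powLift, Complex.add_im, Complex.ofReal_im, Complex.im_ofReal_mul]; simp
  rw [expDisc, expDisc, ← Complex.exp_nat_mul, hre, him]
  congr 1
  push_cast
  ring

lemma powLift_add_mul_I (m : ℕ) (w : ℂ) (θ : ℝ) :
    powLift m (w + θ * Complex.I) = powLift m w + (m * θ : ℝ) * Complex.I := by
  simp [powLift]
  ring

/-- A local section of `expDisc` with prescribed argument at `v₀`. -/
def logDisc (v₀ v : ℂ) : ℂ :=
  (Real.log (-Real.log ‖v‖) : ℝ) + ((v / v₀).arg + v₀.arg : ℝ) * Complex.I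

lemma expDisc_logDisc {v₀ v : ℂ} (h₀ : v₀ ≠ 0) (hv : v ∈ Metric.ball (0 : ℂ) 1) (hv0 : v ≠ 0) :
    expDisc (logDisc v₀ v) = v := by
  have h1 : 0 < ‖v‖ := norm_pos_iff.2 hv0
  have h2 : 0 < -Real.log ‖v‖ := by
    rw [mem_ball_zero_iff] at hv
    linarith [Real.log_neg h1 hv]
  have hre : (logDisc v₀ v).re = Real.log (-Real.log ‖v‖) := by simp [logDisc]
  have him : (logDisc v₀ v).im = (v / v₀).arg + v₀.arg := by simp [logDisc]
  rw [expDisc, hre, him, Real.exp_log h2, Complex.exp_add, Complex.ofReal_add, add_mul,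
    Complex.exp_add]
  have e1 : Complex.exp (-((-Real.log ‖v‖ : ℝ) : ℂ)) = ‖v‖ := by
    rw [← Complex.ofReal_neg, neg_neg, ← Complex.ofReal_exp, Real.exp_log h1]
  have e2 := Complex.norm_mul_exp_arg_mul_I (v / v₀)
  have e3 := Complex.norm_mul_exp_arg_mul_I v₀
  have h3 : (‖v₀‖ : ℂ) ≠ 0 := by exact_mod_cast norm_ne_zero_iff.2 h₀
  rw [norm_div, Complex.ofReal_div] at e2
  rw [e1]
  calc (‖v‖ : ℂ) * (Complex.exp ((v / v₀).arg * Complex.I) * Complex.exp (v₀.arg * Complex.I))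
      = (‖v‖ / ‖v₀‖ * Complex.exp ((v / v₀).arg * Complex.I)) *
        (‖v₀‖ * Complex.exp (v₀.arg * Complex.I)) := by field_simp
    _ = v := by rw [e2, e3, div_mul_cancel₀ _ h₀]

/-- Near `v₀` the quotient `v / v₀` is close to `1`, so its argument avoids the cut; this is the
purpose of the base point in `logDisc`. -/
lemma continuousAt_logDisc {v₀ : ℂ} (hv : v₀ ∈ Metric.ball (0 : ℂ) 1) (h₀ : v₀ ≠ 0) :
    ContinuousAt (logDisc v₀) v₀ := by
  have h1 : 0 < ‖v₀‖ := norm_pos_iff.2 h₀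
  have h2 : -Real.log ‖v₀‖ ≠ 0 := by
    rw [mem_ball_zero_iff] at hv
    have := Real.log_neg h1 hv
    linarith
  have c1 : ContinuousAt (fun v : ℂ ↦ Real.log (-Real.log ‖v‖)) v₀ :=
    ((continuous_norm.continuousAt.log h1.ne').neg).log h2
  have c2 : ContinuousAt (fun v : ℂ ↦ (v / v₀).arg) v₀ := by
    refine ContinuousAt.comp' (g := Complex.arg) (f := fun v ↦ v / v₀)
      (Complex.continuousAt_arg ?_) (by fun_prop)
    simp [div_self h₀]
  unfold logDisc
  exact (Complex.continuous_ofReal.continuousAt.comp' c1).add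
    ((Complex.continuous_ofReal.continuousAt.comp' (c2.add continuousAt_const)).mul
      continuousAt_const)

/-- A continuous integer valued monodromy of logarithms is constant. -/
lemma exists_int_of_continuous {d : ℂ → ℝ} (hd : Continuous d) (h : ∀ w, ∃ n : ℤ, d w = n) :
    ∃ n : ℤ, ∀ w, d w = n := by
  choose n hn using h
  have hc : Continuous n := by
    rw [Int.isClosedEmbedding_coe_real.isEmbedding.continuous_iff]
    exact hd.congr hn
  refine ⟨n 0, fun w ↦ ?_⟩
  rw [hn w, PreconnectedSpace.constant inferInstance hc]

lemma exists_continuous_circle_lift {f : ℂ → Circle} (hf : Continuous f) :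
    ∃ L : ℂ → ℝ, Continuous L ∧ ∀ w, Circle.exp (L w) = f w := by
  obtain ⟨l, hl, h⟩ := Complex.exists_continuousOn_eqOn_exp_comp (U := (univ : Set ℂ))
    (by
      have : ContractibleSpace (univ : Set ℂ) := convex_univ.contractibleSpace univ_nonempty
      exact SimplyConnectedSpace.ofContractible _) isOpen_univ
    (g := fun w ↦ (f w : ℂ)) (by fun_prop) (by simp)
  refine ⟨fun w ↦ (l w).im, Complex.continuous_im.comp (continuousOn_univ.1 hl), fun w ↦ ?_⟩
  have h1 : Complex.exp (l w) = f w := h (mem_univ w)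
  have h2 := congrArg norm h1
  rw [Complex.norm_exp, Circle.norm_coe, Real.exp_eq_one_iff] at h2
  refine Circle.coe_injective ?_
  rw [Circle.coe_exp, ← h1]
  congr 1
  apply Complex.ext <;> simp [h2]

/-- Roots of a circle valued function on the punctured disc, after a cyclic base change. -/
theorem exists_circle_root {Q : ℂ → Circle}
    (hQ : ∀ b ∈ Metric.ball (0 : ℂ) 1, b ≠ 0 → ContinuousAt Q b) {k : ℕ} (hk : 0 < k) :
    ∃ (m : ℕ) (q : ℂ → Circle) (ζ : Circle), 0 < m ∧ ζ ^ k = 1 ∧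
      (∀ v ∈ Metric.ball (0 : ℂ) 1, v ≠ 0 → ContinuousAt q v ∧ q v ^ k = Q (v ^ m)) ∧
      (∀ ε : ℂ, ε ^ m = 1 → ∃ n : ℤ, ∀ v ∈ Metric.ball (0 : ℂ) 1, v ≠ 0 →
        q (ε * v) = q v * ζ ^ n) ∧
      (∀ n : ℤ, ∃ ε : ℂ, ε ^ m = 1 ∧ ∀ v ∈ Metric.ball (0 : ℂ) 1, v ≠ 0 →
        q (ε * v) = q v * ζ ^ n) ∧
      (∀ ε : ℂ, ε ^ m = 1 → ∀ v ∈ Metric.ball (0 : ℂ) 1, v ≠ 0 → q (ε * v) = q v → ε = 1) := by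
  have hkR : (k : ℝ) ≠ 0 := by exact_mod_cast hk.ne'
  have hpi := Real.two_pi_pos.ne'
  have hQE : Continuous (Q ∘ expDisc) := by
    rw [continuous_iff_continuousAt]
    intro w
    exact (hQ _ (expDisc_mem_ball w) (expDisc_ne_zero w)).comp continuous_expDisc.continuousAt
  obtain ⟨L, hL, hLQ⟩ := exists_continuous_circle_lift hQE
  -- The integer `c` is the winding number of `Q` around the puncture.
  obtain ⟨c, hc⟩ : ∃ c : ℤ, ∀ w, (L (w + (2 * Real.pi : ℝ) * Complex.I) - L w) / (2 * Real.pi) =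
      c := by
    refine exists_int_of_continuous (by fun_prop) fun w ↦ ?_
    have h1 : Circle.exp (L (w + (2 * Real.pi : ℝ) * Complex.I)) = Circle.exp (L w) := by
      rw [hLQ, hLQ, Function.comp_apply, expDisc_add_mul_I]
      simp
    obtain ⟨n, hn⟩ := Circle.exp_eq_exp.1 h1
    refine ⟨n, ?_⟩
    rw [hn]
    field_simp
    ring
  have hper : ∀ w, L (w + (2 * Real.pi : ℝ) * Complex.I) = L w + c * (2 * Real.pi) := by
    intro w
    have := hc w
    rw [div_eq_iff hpi] at this
    linarith
  let q₀ : ℂ → Circle := fun w ↦ Circle.exp (L w / k)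
  -- Dividing the lifted argument by `k` gives a `k`-th root on the plane, and one turn around the
  -- puncture multiplies it by `ζ`.
  let ζ : Circle := Circle.exp (c * (2 * Real.pi) / k)
  have hq₀c : Continuous q₀ := by fun_prop
  have hq₀k : ∀ w, q₀ w ^ k = Q (expDisc w) := by
    intro w
    rw [← Circle.exp_nsmul, nsmul_eq_mul, mul_div_cancel₀ _ hkR]
    exact hLQ w
  have hζ : ζ ^ k = 1 := by
    rw [← Circle.exp_nsmul, nsmul_eq_mul, mul_div_cancel₀ _ hkR]
    exact Circle.exp_int_mul_two_pi c
  have hstep : ∀ w, q₀ (w + (2 * Real.pi : ℝ) * Complex.I) = q₀ w * ζ := by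
    intro w
    simp only [q₀, ζ, hper, add_div, Circle.exp_add]
  have hsteps : ∀ (n : ℤ) w, q₀ (w + (n * (2 * Real.pi) : ℝ) * Complex.I) = q₀ w * ζ ^ n := by
    intro n
    induction n using Int.induction_on with
    | zero => intro w; simp
    | succ n ih =>
      intro w
      rw [zpow_add_one, ← mul_assoc (q₀ w), ← ih w, ← hstep]
      congr 1
      push_cast
      ring
    | pred n ih =>
      intro w
      rw [zpow_sub_one, ← mul_assoc (q₀ w), ← ih w, eq_mul_inv_iff_mul_eq, ← hstep]
      congr 1
      push_cast
      ring
  -- With `m` the order of `ζ`, the root becomes single-valued on the `m`-fold cover, and no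
  -- nontrivial deck rotation fixes it.
  let m := orderOf ζ
  have hm : 0 < m := orderOf_pos_iff.2 (isOfFinOrder_iff_pow_eq_one.2 ⟨k, hk, hζ⟩)
  have hmR : (m : ℝ) ≠ 0 := by exact_mod_cast hm.ne'
  let q : ℂ → Circle := fun v ↦ q₀ (powLift m (logDisc 1 v))
  have hq : ∀ w, q (expDisc w) = q₀ (powLift m w) := by
    intro w
    obtain ⟨n, hn⟩ := expDisc_eq_iff (w := logDisc 1 (expDisc w)) (w' := w)
      (expDisc_logDisc one_ne_zero (expDisc_mem_ball w) (expDisc_ne_zero w))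
    -- Two logarithms of the same point differ by `n` turns. `powLift` turns these into `m * n`
    -- turns, which contribute `ζ ^ (m * n) = 1`.
    have h1 : ((m * (n * (2 * Real.pi)) : ℝ)) = ((m * n : ℤ) : ℝ) * (2 * Real.pi) := by
      push_cast; ring
    simp only [q]
    rw [hn, powLift_add_mul_I, h1, hsteps, zpow_mul, zpow_natCast, pow_orderOf_eq_one, one_zpow,
      mul_one]
  have hrot : ∀ (n : ℤ), ∀ v ∈ Metric.ball (0 : ℂ) 1, v ≠ 0 →
      q (Complex.exp ((n * (2 * Real.pi) / m : ℝ) * Complex.I) * v) = q v * ζ ^ n := by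
    intro n v hv h0
    have hE := expDisc_logDisc (v₀ := 1) one_ne_zero hv h0
    rw [← hE, ← expDisc_add_mul_I, hq, hq, powLift_add_mul_I, mul_div_cancel₀ _ hmR, hsteps]
  have hroot : ∀ ε : ℂ, ε ^ m = 1 → ∃ n : ℤ,
      ε = Complex.exp ((n * (2 * Real.pi) / m : ℝ) * Complex.I) := by
    intro ε hε
    have h0 : ε ≠ 0 := by
      rintro rfl
      rw [zero_pow hm.ne'] at hε
      exact zero_ne_one hε
    rw [← Complex.exp_log h0, ← Complex.exp_nat_mul, Complex.exp_eq_one_iff] at hε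
    obtain ⟨n, hn⟩ := hε
    refine ⟨n, ?_⟩
    rw [← Complex.exp_log h0]
    congr 1
    have hmC : (m : ℂ) ≠ 0 := by exact_mod_cast hm.ne'
    push_cast
    field_simp
    linear_combination hn
  refine ⟨m, q, ζ, hm, hζ, ?_, ?_, ?_, ?_⟩
  · intro v hv h0
    constructor
    -- The function `q` is defined through `logDisc 1`, which jumps across the cut; near `v` the
    -- branch `logDisc v` gives the same values and is continuous.
    · have h1 : ContinuousAt (fun w ↦ q₀ (powLift m (logDisc v w))) v :=
        (hq₀c.comp (continuous_powLift m)).continuousAt.comp' (continuousAt_logDisc hv h0)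
      refine h1.congr ?_
      filter_upwards [Metric.isOpen_ball.mem_nhds hv, isOpen_ne.mem_nhds h0] with w hw hw0
      rw [← hq, expDisc_logDisc h0 hw hw0]
    · have hE := expDisc_logDisc (v₀ := 1) one_ne_zero hv h0
      rw [← hE, hq, hq₀k, expDisc_powLift hm]
  · intro ε hε
    obtain ⟨n, rfl⟩ := hroot ε hε
    exact ⟨n, hrot n⟩
  · intro n
    refine ⟨_, ?_, hrot n⟩
    rw [← Complex.exp_nat_mul, Complex.exp_eq_one_iff]
    refine ⟨n, ?_⟩
    have hmC : (m : ℂ) ≠ 0 := by exact_mod_cast hm.ne'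
    push_cast
    field_simp
  · intro ε hε v hv h0 h
    obtain ⟨n, rfl⟩ := hroot ε hε
    rw [hrot n v hv h0, mul_eq_left, ← orderOf_dvd_iff_zpow_eq_one] at h
    obtain ⟨j, hj⟩ := h
    rw [Complex.exp_eq_one_iff]
    refine ⟨j, ?_⟩
    have hmC : (m : ℂ) ≠ 0 := by exact_mod_cast hm.ne'
    have hj' : (n : ℂ) = m * j := by exact_mod_cast hj
    push_cast
    rw [hj']
    field_simp

end PuncturedDisc

/-! ### Directions of complex numbers and roots of unity on the circle. -/

section Direction

/-- The direction of a nonzero complex number. -/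
def dir (v : ℂ) : Circle := Circle.exp (Complex.arg v)

lemma norm_mul_dir (v : ℂ) : (‖v‖ : ℂ) * dir v = v := by
  rw [dir, Circle.coe_exp, Complex.norm_mul_exp_arg_mul_I]

lemma dir_mul {v w : ℂ} (hv : v ≠ 0) (hw : w ≠ 0) : dir (v * w) = dir v * dir w := by
  have h0 : (‖v‖ : ℂ) * ‖w‖ ≠ 0 := by simp [hv, hw]
  refine Circle.ext (mul_left_cancel₀ h0 ?_)
  have h1 := norm_mul_dir (v * w)
  rw [norm_mul, Complex.ofReal_mul] at h1
  rw [h1, Circle.coe_mul, mul_mul_mul_comm, norm_mul_dir, norm_mul_dir]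

lemma dir_one : dir 1 = 1 := by simp [dir]

lemma dir_pow {v : ℂ} (hv : v ≠ 0) (n : ℕ) : dir (v ^ n) = dir v ^ n := by
  induction n with
  | zero => simp [dir_one]
  | succ n ih => rw [pow_succ, dir_mul (pow_ne_zero n hv) hv, ih, pow_succ]

lemma continuousAt_dir {v : ℂ} (hv : v ≠ 0) : ContinuousAt dir v := by
  have hi : Topology.IsInducing (X := Circle) (fun a ↦ (a : ℂ)) := ⟨rfl⟩
  refine hi.continuousAt_iff.2 ?_
  have h : ContinuousAt (fun w : ℂ ↦ w / (‖w‖ : ℂ)) v :=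
    continuousAt_id.div (by fun_prop) (by simpa using hv)
  refine h.congr ?_
  filter_upwards [isOpen_ne.mem_nhds hv] with w hw
  rw [div_eq_iff (by simpa using hw), mul_comm]
  exact (norm_mul_dir w).symm

/-- The group of `k`-th roots of unity in the circle. -/
abbrev CircleRoots (k : ℕ) : Type := (powMonoidHom k : Circle →* Circle).ker

lemma finite_circleRoots {k : ℕ} (hk : 0 < k) : Finite (CircleRoots k) := by
  refine Finite.of_injective
    (fun a : CircleRoots k ↦ (⟨(a : Circle), (Polynomial.mem_nthRootsFinset hk (1 : ℂ)).2 ?_⟩ :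
      Polynomial.nthRootsFinset k (1 : ℂ))) ?_
  · rw [← Circle.coe_pow]
    exact congrArg _ a.2
  · intro a b h
    have h' := congrArg Subtype.val h
    exact Subtype.ext (Circle.ext h')

open Classical in
/-- A `k`-th root of unity as an element of the group of roots of unity. -/
def toRoot (k : ℕ) (a : Circle) : CircleRoots k := if h : a ^ k = 1 then ⟨a, h⟩ else 1

lemma coe_toRoot {k : ℕ} {a : Circle} (h : a ^ k = 1) : (toRoot k a : Circle) = a := by
  rw [toRoot, dif_pos h]

/-- The `k`-th roots of unity form a finite, hence discrete, set, so a continuous function with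
values in it is locally constant. -/
lemma ContinuousAt.eventually_eq_of_pow_eq_one {X : Type*} [TopologicalSpace X] {R : X → Circle}
    {x : X} {k : ℕ} (hk : 0 < k) (hR : ContinuousAt R x) (h : ∀ᶠ y in 𝓝 x, R y ^ k = 1) :
    ∀ᶠ y in 𝓝 x, R y = R x := by
  have hfin : {a : Circle | a ^ k = 1}.Finite := by
    have := finite_circleRoots hk
    exact Set.toFinite ((powMonoidHom k : Circle →* Circle).ker : Set Circle)
  have hopen : ({a : Circle | a ^ k = 1} \ {R x})ᶜ ∈ 𝓝 (R x) :=
    (hfin.subset sdiff_subset).isClosed.isOpen_compl.mem_nhds (by simp)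
  filter_upwards [h, hR hopen] with y h1 h2
  by_contra h3
  exact h2 ⟨h1, h3⟩

end Direction

/-! ### The flat structure of the connection and the directions of its cocycle. -/

section FlatAtlas

variable {S : Type u} [TopologicalSpace S] [ChartedSpace ℂ S]

/-- Charts covering `U` with primitives of the local representations of a connection, such that
the directions of the associated cocycle are `k`-th roots of unity. -/
structure FlatAtlas (cov : TangentOperator S) (U : Set S) (k : ℕ) where
  charts : Set (OpenPartialHomeomorph S ℂ)
  prim : OpenPartialHomeomorph S ℂ → S → ℂ
  mem_maximalAtlas : ∀ z ∈ charts, z ∈ IsManifold.maximalAtlas 𝓘(ℂ, ℂ) ω S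
  pick : S → OpenPartialHomeomorph S ℂ
  pick_mem : ∀ y ∈ U, pick y ∈ charts
  mem_pick_source : ∀ y ∈ U, y ∈ (pick y).source
  mdifferentiableAt_prim : ∀ z ∈ charts, ∀ x ∈ z.source,
    MDifferentiableAt 𝓘(ℂ, ℂ) 𝓘(ℂ, ℂ) (prim z) x
  mvfderiv_prim : ∀ z ∈ charts, ∀ x ∈ z.source,
    mvfderiv 𝓘(ℂ, ℂ) (prim z) x = localRep cov z x
  dir_cocycle_pow : ∀ z ∈ charts, ∀ w ∈ charts, ∀ x ∈ z.source ∩ w.source,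
    dir (Complex.exp (prim z x) / Complex.exp (prim w x) * chartRatio z w x) ^ k = 1

lemma HasMonodromyIn.nonempty_flatAtlas {cov : TangentOperator S} {U : Set S} {G : Subgroup ℂˣ}
    (h : HasMonodromyIn cov U G) {k : ℕ}
    (hG : ∀ a ∈ G, Complex.arg ((a : ℂ) ^ k) = 0) : Nonempty (FlatAtlas cov U k) := by
  obtain ⟨A, K, hA, hU, hK, hg⟩ := h
  have hpick : ∀ y, ∃ z, y ∈ U → z ∈ A ∧ y ∈ z.source := by
    intro y
    by_cases hy : y ∈ U
    · rw [← hU] at hy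
      obtain ⟨z, hz, hyz⟩ := mem_iUnion₂.1 hy
      exact ⟨z, fun _ ↦ ⟨hz, hyz⟩⟩
    · exact ⟨chartAt ℂ y, fun h ↦ absurd h hy⟩
  choose p hp using hpick
  refine ⟨⟨A, K, hA, p, fun y hy ↦ (hp y hy).1, fun y hy ↦ (hp y hy).2,
    fun z hz x hx ↦ (hK z hz x hx).1, fun z hz x hx ↦ (hK z hz x hx).2, ?_⟩⟩
  intro z hz w hw x hx
  obtain ⟨g, hgG, hgx⟩ := hg z hz w hw x hx
  -- Having `arg (g ^ k) = 0` means that `g ^ k` has direction `1`, so the direction of `g` is a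
  -- `k`-th root of unity.
  rw [hgx, ← dir_pow g.ne_zero, dir, hG g hgG, Circle.exp_zero]

namespace FlatAtlas

variable {cov : TangentOperator S} {U : Set S} {k : ℕ} (F : FlatAtlas cov U k)
  [IsManifold 𝓘(ℂ, ℂ) ω S]

/-- The factor comparing a chart `u` with the flat coordinate given by the chart `z`. -/
def flat (z u : OpenPartialHomeomorph S ℂ) (y : S) : ℂ :=
  Complex.exp (F.prim z y) * chartRatio z u y

/-- The cocycle of the flat structure. -/
def cocycle (z w : OpenPartialHomeomorph S ℂ) (y : S) : ℂ :=
  Complex.exp (F.prim z y) / Complex.exp (F.prim w y) * chartRatio z w y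

variable {z w u : OpenPartialHomeomorph S ℂ} {y : S}

lemma flat_ne_zero (hz : z ∈ F.charts) (hu : u ∈ IsManifold.maximalAtlas 𝓘(ℂ, ℂ) ω S)
    (hyz : y ∈ z.source) (hyu : y ∈ u.source) : F.flat z u y ≠ 0 :=
  mul_ne_zero (Complex.exp_ne_zero _) (chartRatio_ne_zero (F.mem_maximalAtlas z hz) hu hyz hyu)

lemma cocycle_ne_zero (hz : z ∈ F.charts) (hw : w ∈ F.charts)
    (hyz : y ∈ z.source) (hyw : y ∈ w.source) : F.cocycle z w y ≠ 0 :=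
  mul_ne_zero (div_ne_zero (Complex.exp_ne_zero _) (Complex.exp_ne_zero _))
    (chartRatio_ne_zero (F.mem_maximalAtlas z hz) (F.mem_maximalAtlas w hw) hyz hyw)

lemma cocycle_mul_flat (hz : z ∈ F.charts) (hw : w ∈ F.charts)
    (hu : u ∈ IsManifold.maximalAtlas 𝓘(ℂ, ℂ) ω S)
    (hyz : y ∈ z.source) (hyw : y ∈ w.source) (hyu : y ∈ u.source) :
    F.cocycle z w y * F.flat w u y = F.flat z u y := by
  rw [cocycle, flat, flat, ← chartRatio_mul (F.mem_maximalAtlas z hz) (F.mem_maximalAtlas w hw) hu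
    hyz hyw hyu]
  have := Complex.exp_ne_zero (F.prim w y)
  field_simp

lemma dir_flat (hz : z ∈ F.charts) (hw : w ∈ F.charts)
    (hu : u ∈ IsManifold.maximalAtlas 𝓘(ℂ, ℂ) ω S)
    (hyz : y ∈ z.source) (hyw : y ∈ w.source) (hyu : y ∈ u.source) :
    dir (F.flat z u y) = dir (F.cocycle z w y) * dir (F.flat w u y) := by
  rw [← F.cocycle_mul_flat hz hw hu hyz hyw hyu,
    dir_mul (F.cocycle_ne_zero hz hw hyz hyw) (F.flat_ne_zero hw hu hyw hyu)]

/-- Cocycle directions are killed by the `k`-th power, so this power does not depend on the flat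
chart. It thus defines a function on all of `u.source ∩ Pᶜ` when `U = Pᶜ`. -/
lemma dir_flat_pow (hz : z ∈ F.charts) (hw : w ∈ F.charts)
    (hu : u ∈ IsManifold.maximalAtlas 𝓘(ℂ, ℂ) ω S)
    (hyz : y ∈ z.source) (hyw : y ∈ w.source) (hyu : y ∈ u.source) :
    dir (F.flat z u y) ^ k = dir (F.flat w u y) ^ k := by
  rw [F.dir_flat hz hw hu hyz hyw hyu, mul_pow]
  erw [F.dir_cocycle_pow z hz w hw y ⟨hyz, hyw⟩]
  rw [one_mul]

lemma continuousAt_dir_flat (hz : z ∈ F.charts) (hu : u ∈ IsManifold.maximalAtlas 𝓘(ℂ, ℂ) ω S)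
    (hyz : y ∈ z.source) (hyu : y ∈ u.source) :
    ContinuousAt (fun y ↦ dir (F.flat z u y)) y := by
  refine ContinuousAt.comp' (continuousAt_dir (F.flat_ne_zero hz hu hyz hyu)) ?_
  have h1 : ContinuousAt (fun y ↦ Complex.exp (F.prim z y)) y :=
    Complex.continuous_exp.continuousAt.comp' (F.mdifferentiableAt_prim z hz y hyz).continuousAt
  have h2 : ContinuousAt (chartRatio z u) y := by
    have h := (contMDiffAt_iff_comp_symm hu hyu).2
      (analyticAt_chartRatio_comp_symm (F.mem_maximalAtlas z hz) hu hyz hyu)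
    exact h.continuousAt
  exact h1.mul h2

end FlatAtlas

end FlatAtlas

/-! ### Small unit-disc charts around a point. -/

section Discs

variable {S : Type u} [TopologicalSpace S] [ChartedSpace ℂ S] [IsManifold 𝓘(ℂ, ℂ) ω S]

lemma exists_disc_chart (x : S) {W : Set S} (hW : W ∈ 𝓝 x) :
    ∃ u ∈ IsManifold.maximalAtlas 𝓘(ℂ, ℂ) ω S, u.target = Metric.ball 0 1 ∧ x ∈ u.source ∧
      u x = 0 ∧ u.source ⊆ W := by
  let e := chartAt ℂ x
  have hx : x ∈ e.source := mem_chart_source ℂ x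
  have h1 : e.target ∩ e.symm ⁻¹' W ∈ 𝓝 (e x) := by
    refine inter_mem (e.open_target.mem_nhds (e.map_source hx)) ?_
    refine (e.continuousAt_symm (e.map_source hx)) ?_
    rwa [e.left_inv hx]
  obtain ⟨r, hr, hball⟩ := Metric.mem_nhds_iff.1 h1
  have hr' : (r : ℂ) ≠ 0 := by exact_mod_cast hr.ne'
  have hmaps : ∀ v ∈ Metric.ball (0 : ℂ) 1, e x + r * v ∈ Metric.ball (e x) r := by
    intro v hv
    rw [mem_ball_zero_iff] at hv
    rw [Metric.mem_ball, dist_eq_norm, add_sub_cancel_left, norm_mul, Complex.norm_real,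
      Real.norm_of_nonneg hr.le]
    exact mul_lt_of_lt_one_right hr hv
  let u : OpenPartialHomeomorph S ℂ :=
    { toFun := fun y ↦ (e y - e x) / r
      invFun := fun v ↦ e.symm (e x + r * v)
      source := e.source ∩ e ⁻¹' Metric.ball (e x) r
      target := Metric.ball 0 1
      map_source' := by
        rintro y ⟨hy, hyr⟩
        rw [mem_preimage, Metric.mem_ball, dist_eq_norm] at hyr
        rw [mem_ball_zero_iff, norm_div, Complex.norm_real, Real.norm_of_nonneg hr.le, div_lt_one hr]
        exact hyr
      map_target' := by
        intro v hv
        have h := hmaps v hv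
        refine ⟨e.map_target (hball h).1, ?_⟩
        rwa [mem_preimage, e.right_inv (hball h).1]
      left_inv' := by
        rintro y ⟨hy, hyr⟩
        rw [mul_div_cancel₀ _ hr', add_sub_cancel, e.left_inv hy]
      right_inv' := by
        intro v hv
        rw [e.right_inv (hball (hmaps v hv)).1, add_sub_cancel_left, mul_div_cancel_left₀ _ hr']
      open_source := e.isOpen_inter_preimage Metric.isOpen_ball
      open_target := Metric.isOpen_ball
      continuousOn_toFun := ((e.continuousOn.mono inter_subset_left).sub continuousOn_const).div_const _
      continuousOn_invFun := e.continuousOn_symm.comp (by fun_prop)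
        fun v hv ↦ (hball (hmaps v hv)).1 }
  have he : e ∈ IsManifold.maximalAtlas 𝓘(ℂ, ℂ) ω S := chartAt_mem_maximalAtlas x
  refine ⟨u, ?_, rfl, ⟨hx, Metric.mem_ball_self hr⟩, ?_, ?_⟩
  · have h1 : ContMDiff 𝓘(ℂ, ℂ) 𝓘(ℂ, ℂ) ω fun b : ℂ ↦ (b - e x) / r :=
      ((contDiff_id.sub contDiff_const).div_const _).contMDiff
    have h2 : ContMDiff 𝓘(ℂ, ℂ) 𝓘(ℂ, ℂ) ω fun v : ℂ ↦ e x + r * v :=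
      (contDiff_const.add (contDiff_const.mul contDiff_id)).contMDiff
    refine OpenPartialHomeomorph.mem_maximalAtlas_of_contMDiffOn u ?_ ?_
    · exact h1.comp_contMDiffOn ((contMDiffOn_of_mem_maximalAtlas he).mono inter_subset_left)
    · exact (contMDiffOn_symm_of_mem_maximalAtlas he).comp h2.contMDiffOn
        fun v hv ↦ (hball (hmaps v hv)).1
  · simp [u]
  · rintro y ⟨hy, hyr⟩
    have := (hball hyr).2
    rwa [mem_preimage, e.left_inv hy] at this

end Discs

/-! ### The covering data attached to the flat structure. -/

section FlatCover

variable {S : Type u} [TopologicalSpace S] [ChartedSpace ℂ S] [IsManifold 𝓘(ℂ, ℂ) ω S]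
  {P : Set S} {cov : TangentOperator S} {k : ℕ}

/-- A disc chart around `x` with a `k`-th root `q`, up to roots of unity, of the direction of the
flat structure, after the cyclic base change of degree `m`. -/
structure FlatAtlas.IsLocalRoot (F : FlatAtlas cov Pᶜ k) (x : S) (u : OpenPartialHomeomorph S ℂ)
    (m : ℕ) (q : ℂ → Circle) (H : Subgroup (CircleRoots k)) : Prop where
  mem_maximalAtlas : u ∈ IsManifold.maximalAtlas 𝓘(ℂ, ℂ) ω S
  target_eq : u.target = Metric.ball 0 1
  mem_source : x ∈ u.source
  map_center : u x = 0
  eq_of_mem : ∀ y ∈ u.source, y ∈ P → y = x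
  pos : 0 < m
  regular : x ∉ P → m = 1 ∧ H = ⊥
  continuousAt : ∀ v ∈ Metric.ball (0 : ℂ) 1, u.symm (v ^ m) ∉ P → ContinuousAt q v
  pow_eq : ∀ v ∈ Metric.ball (0 : ℂ) 1, u.symm (v ^ m) ∉ P →
    q v ^ k = dir (F.flat (F.pick (u.symm (v ^ m))) u (u.symm (v ^ m))) ^ k
  exists_rotation : ∀ g ∈ H, ∃ ε : ℂ, ε ^ m = 1 ∧
    ∀ v ∈ Metric.ball (0 : ℂ) 1, v ≠ 0 → q (ε * v) = q v * g
  exists_mem : ∀ v ∈ Metric.ball (0 : ℂ) 1, v ≠ 0 → ∀ v' : ℂ, v' ^ m = v ^ m →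
    ∃ g ∈ H, q v' = q v * g
  injective : ∀ v ∈ Metric.ball (0 : ℂ) 1, v ≠ 0 → ∀ v' : ℂ, v' ^ m = v ^ m → q v' = q v → v' = v

lemma pow_mem_unitBall {v : ℂ} (hv : v ∈ Metric.ball (0 : ℂ) 1) {m : ℕ} (hm : 0 < m) :
    v ^ m ∈ Metric.ball (0 : ℂ) 1 := by
  rw [mem_ball_zero_iff] at hv ⊢
  rw [norm_pow]
  exact pow_lt_one₀ (norm_nonneg v) hv hm.ne'

/-- At a puncture the root comes from `exists_circle_root`, and `H` is generated by its monodromy.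
At a regular point a small disc lies in a single flat chart, where the flat direction itself is the
root and there is no monodromy. -/
lemma FlatAtlas.exists_isLocalRoot [T2Space S] (F : FlatAtlas cov Pᶜ k) (hP : P.Finite)
    (hk : 0 < k) (x : S) :
    ∃ u m q H, F.IsLocalRoot x u m q H := by
  by_cases hx : x ∈ P
  · have hW : (P \ {x})ᶜ ∈ 𝓝 x :=
      (hP.subset sdiff_subset).isClosed.isOpen_compl.mem_nhds (by simp)
    obtain ⟨u, hu, ht, hxu, hux, hsub⟩ := exists_disc_chart x hW
    have heq : ∀ y ∈ u.source, y ∈ P → y = x := by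
      intro y hy hyP
      by_contra h
      exact hsub hy ⟨hyP, h⟩
    have hsrc : ∀ b ∈ Metric.ball (0 : ℂ) 1, u.symm b ∈ u.source := fun b hb ↦
      u.map_target (ht ▸ hb)
    have hreg : ∀ b ∈ Metric.ball (0 : ℂ) 1, b ≠ 0 → u.symm b ∈ Pᶜ := by
      intro b hb h0 hbP
      apply h0
      rw [← u.right_inv (ht ▸ hb : b ∈ u.target), heq _ (hsrc b hb) hbP, hux]
    have hne : ∀ v ∈ Metric.ball (0 : ℂ) 1, ∀ m : ℕ, 0 < m → u.symm (v ^ m) ∉ P → v ≠ 0 := by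
      rintro v hv m hm h rfl
      rw [zero_pow hm.ne', ← hux, u.left_inv hxu] at h
      exact h hx
    obtain ⟨m, q, ζ, hm, hζ, hq, h1, h2, h3⟩ := exists_circle_root (k := k)
      (Q := fun b ↦ dir (F.flat (F.pick (u.symm b)) u (u.symm b)) ^ k) (by
        intro b hb h0
        have hy := hreg b hb h0
        have hc : ContinuousAt u.symm b := u.continuousAt_symm (ht ▸ hb)
        have h := ((F.continuousAt_dir_flat (F.pick_mem _ hy) hu (F.mem_pick_source _ hy)
          (hsrc b hb)).comp' hc).pow k
        refine h.congr ?_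
        filter_upwards [Metric.isOpen_ball.mem_nhds hb, isOpen_ne.mem_nhds h0,
          hc ((F.pick (u.symm b)).open_source.mem_nhds (F.mem_pick_source _ hy))] with b' hb' h0' hm
        -- The picked chart may jump with the point. The `k`-th power does not see this, so near `b`
        -- it may be computed in the fixed chart picked at `u.symm b`.
        exact F.dir_flat_pow (F.pick_mem _ hy) (F.pick_mem _ (hreg b' hb' h0')) hu hm
          (F.mem_pick_source _ (hreg b' hb' h0')) (hsrc b' hb')) hk
    have hcoe : ∀ n : ℤ, (((⟨ζ, hζ⟩ : CircleRoots k) ^ n : CircleRoots k) : Circle) = ζ ^ n :=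
      fun n ↦ rfl
    have hdiv : ∀ v ∈ Metric.ball (0 : ℂ) 1, v ≠ 0 → ∀ v' : ℂ, v' ^ m = v ^ m →
        (v' / v) ^ m = 1 ∧ v' = v' / v * v := by
      intro v hv h0 v' hv'
      rw [div_pow, hv', div_self (pow_ne_zero m h0), div_mul_cancel₀ _ h0]
      exact ⟨rfl, rfl⟩
    refine ⟨u, m, q, Subgroup.zpowers ⟨ζ, hζ⟩, hu, ht, hxu, hux, heq, hm, fun h ↦ absurd hx h,
      fun v hv hvP ↦ (hq v hv (hne v hv m hm hvP)).1,
      fun v hv hvP ↦ (hq v hv (hne v hv m hm hvP)).2, ?_, ?_, ?_⟩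
    · rintro _ ⟨n, rfl⟩
      exact h2 n
    · intro v hv h0 v' hv'
      obtain ⟨he, hv''⟩ := hdiv v hv h0 v' hv'
      obtain ⟨n, hn⟩ := h1 _ he
      refine ⟨⟨ζ, hζ⟩ ^ n, ⟨n, rfl⟩, ?_⟩
      rw [hcoe, ← hn v hv h0, ← hv'']
    · intro v hv h0 v' hv' h
      obtain ⟨he, hv''⟩ := hdiv v hv h0 v' hv'
      rw [hv''] at h
      rw [hv'', h3 _ he v hv h0 h, one_mul]
  · have hx' : x ∈ Pᶜ := hx
    have hW : (F.pick x).source ∩ Pᶜ ∈ 𝓝 x :=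
      inter_mem ((F.pick x).open_source.mem_nhds (F.mem_pick_source x hx'))
        (hP.isClosed.isOpen_compl.mem_nhds hx')
    obtain ⟨u, hu, ht, hxu, hux, hsub⟩ := exists_disc_chart x hW
    have hsrc : ∀ b ∈ Metric.ball (0 : ℂ) 1, u.symm b ∈ u.source := fun b hb ↦
      u.map_target (ht ▸ hb)
    refine ⟨u, 1, fun v ↦ dir (F.flat (F.pick x) u (u.symm v)), ⊥, hu, ht, hxu, hux,
      fun y hy hyP ↦ absurd hyP (hsub hy).2, one_pos, fun _ ↦ ⟨rfl, rfl⟩, ?_, ?_, ?_, ?_, ?_⟩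
    · intro v hv _
      exact (F.continuousAt_dir_flat (F.pick_mem x hx') hu (hsub (hsrc v hv)).1
          (hsrc v hv)).comp' (u.continuousAt_symm (ht ▸ hv))
    · intro v hv hvP
      rw [pow_one] at hvP ⊢
      exact F.dir_flat_pow (F.pick_mem x hx') (F.pick_mem _ hvP) hu (hsub (hsrc v hv)).1
        (F.mem_pick_source _ hvP) (hsrc v hv)
    · intro g hg
      rw [Subgroup.mem_bot] at hg
      exact ⟨1, by simp, by simp [hg]⟩
    · intro v _ _ v' hv'
      rw [pow_one, pow_one] at hv'
      exact ⟨1, one_mem _, by simp [hv']⟩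
    · intro v _ _ v' hv' _
      simpa using hv'

/-- The change of the flat coordinate between the picked charts, up to positive factors. -/
def FlatAtlas.transport (F : FlatAtlas cov Pᶜ k) (y₀ y : S) : CircleRoots k :=
  toRoot k (dir (F.cocycle (F.pick y) (F.pick y₀) y))

lemma FlatAtlas.coe_transport (F : FlatAtlas cov Pᶜ k) {y₀ y : S} (h₀ : y₀ ∈ Pᶜ) (h : y ∈ Pᶜ)
    (hy : y ∈ (F.pick y₀).source) :
    (F.transport y₀ y : Circle) = dir (F.cocycle (F.pick y) (F.pick y₀) y) :=
  coe_toRoot (F.dir_cocycle_pow _ (F.pick_mem y h) _ (F.pick_mem y₀ h₀) y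
    ⟨F.mem_pick_source y h, hy⟩)

theorem FlatAtlas.exists_coverData [T2Space S] (F : FlatAtlas cov Pᶜ k) (hP : P.Finite)
    (hk : 0 < k) : ∃ c : CoverData S P (CircleRoots k), c.transport = F.transport := by
  choose u m q H hL using F.exists_isLocalRoot hP hk
  let base : S → ℂ → S := fun x v ↦ (u x).symm (v ^ m x)
  -- The local root is compared with the direction in the picked chart; their `k`-th powers agree
  -- over `Pᶜ`. At the centre of a branched disc the value is irrelevant.
  let sheet : S → ℂ → CircleRoots k := fun x v ↦
    toRoot k (q x v / dir (F.flat (F.pick (base x v)) (u x) (base x v)))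
  have hsrc : ∀ x, ∀ v ∈ Metric.ball (0 : ℂ) 1, base x v ∈ (u x).source := fun x v hv ↦
    (u x).map_target ((hL x).target_eq ▸ pow_mem_unitBall hv (hL x).pos)
  have hreg : ∀ x, ∀ v ∈ Metric.ball (0 : ℂ) 1, v ≠ 0 → base x v ∈ Pᶜ := by
    intro x v hv h0 hvP
    have h1 : v ^ m x ∈ (u x).target := (hL x).target_eq ▸ pow_mem_unitBall hv (hL x).pos
    refine pow_ne_zero (m x) h0 ?_
    have h2 : u x (base x v) = v ^ m x := (u x).right_inv h1
    rw [← h2, (hL x).eq_of_mem _ (hsrc x v hv) hvP, (hL x).map_center]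
  -- Only equality of `k`-th powers is required here, so the formula also applies to a rotated
  -- parameter `v'` without first placing it in the ball.
  have hsheet' : ∀ x v, q x v ^ k = dir (F.flat (F.pick (base x v)) (u x) (base x v)) ^ k →
      (sheet x v : Circle) = q x v / dir (F.flat (F.pick (base x v)) (u x) (base x v)) := by
    intro x v h
    refine coe_toRoot ?_
    rw [div_pow, h, div_self']
  have hsheet : ∀ x, ∀ v ∈ Metric.ball (0 : ℂ) 1, base x v ∈ Pᶜ →
      (sheet x v : Circle) = q x v / dir (F.flat (F.pick (base x v)) (u x) (base x v)) :=
    fun x v hv hvP ↦ hsheet' x v ((hL x).pow_eq v hv hvP)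
  have hmul : ∀ x, ∀ v ∈ Metric.ball (0 : ℂ) 1, v ≠ 0 → ∀ v', v' ^ m x = v ^ m x →
      ∀ g : CircleRoots k, q x v' = q x v * g → sheet x v' = sheet x v * g := by
    intro x v hv h0 v' hv' g hg
    have hb : base x v' = base x v := by simp only [base, hv']
    have hp : q x v' ^ k = q x v ^ k := by
      have hgk : (g : Circle) ^ k = 1 := g.2
      rw [hg, mul_pow, hgk, mul_one]
    refine Subtype.ext ?_
    rw [hsheet' x v' (by rw [hp, hb]; exact (hL x).pow_eq v hv (hreg x v hv h0)), hb,
      Subgroup.coe_mul, hsheet x v hv (hreg x v hv h0), hg, mul_div_right_comm]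
  refine ⟨{
    chart := u
    chart_mem := fun x ↦ (hL x).mem_maximalAtlas
    target_eq := fun x ↦ (hL x).target_eq
    mem_source := fun x ↦ (hL x).mem_source
    map_center := fun x ↦ (hL x).map_center
    eq_of_mem := fun x ↦ (hL x).eq_of_mem
    deg := m
    deg_pos := fun x ↦ (hL x).pos
    sheet := sheet
    stab := H
    deg_regular := fun x hx ↦ ((hL x).regular hx).1
    stab_regular := fun x hx ↦ ((hL x).regular hx).2
    exists_rotation := ?_
    div_mem_stab := ?_
    sheet_injective := ?_
    transport := F.transport
    eventually_sheet := ?_ }, rfl⟩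
  · intro x g hg
    obtain ⟨ε, hε, h⟩ := (hL x).exists_rotation g hg
    refine ⟨ε, hε, fun v hv h0 ↦ hmul x v hv h0 _ ?_ g (h v hv h0)⟩
    rw [mul_pow, hε, one_mul]
  · intro x v hv h0 v' hv'
    obtain ⟨g, hg, h⟩ := (hL x).exists_mem v hv h0 v' hv'
    rwa [hmul x v hv h0 v' hv' g h, mul_div_cancel_left]
  · intro x v hv h0 v' hv' h
    obtain ⟨g, hg, h'⟩ := (hL x).exists_mem v hv h0 v' hv'
    rw [hmul x v hv h0 v' hv' g h', mul_eq_left] at h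
    refine (hL x).injective v hv h0 v' hv' ?_
    rw [h', h, Subgroup.coe_one, mul_one]
  · intro y₀ hy₀ x v₀ hv₀ hb₀
    have hy₀' : y₀ ∈ Pᶜ := hy₀
    have hb₀' : base x v₀ = y₀ := hb₀
    have hbc : ContinuousAt (base x) v₀ :=
      ((u x).continuousAt_symm ((hL x).target_eq ▸ pow_mem_unitBall hv₀ (hL x).pos)).comp'
        (continuousAt_id.pow _)
    have hbP : base x v₀ ∈ Pᶜ := hb₀'.symm ▸ hy₀'
    have hbs : base x v₀ ∈ (F.pick y₀).source := hb₀'.symm ▸ F.mem_pick_source _ hy₀'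
    have hsrc₀ : y₀ ∈ (u x).source := hb₀' ▸ hsrc x v₀ hv₀
    have hR : ContinuousAt (fun v ↦ q x v / dir (F.flat (F.pick y₀) (u x) (base x v))) v₀ := by
      refine ((hL x).continuousAt v₀ hv₀ hbP).div' (ContinuousAt.comp_of_eq
        (g := fun y ↦ dir (F.flat (F.pick y₀) (u x) y)) ?_ hbc hb₀')
      exact F.continuousAt_dir_flat (F.pick_mem _ hy₀') (hL x).mem_maximalAtlas
        (F.mem_pick_source _ hy₀') hsrc₀
    have hgood : ∀ᶠ v in 𝓝 v₀, v ∈ Metric.ball (0 : ℂ) 1 ∧ base x v ∈ Pᶜ ∧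
        base x v ∈ (F.pick y₀).source := by
      filter_upwards [Metric.isOpen_ball.mem_nhds hv₀,
        hbc (hP.isClosed.isOpen_compl.mem_nhds hbP), hbc ((F.pick y₀).open_source.mem_nhds hbs)]
        with v h1 h2 h3 using ⟨h1, h2, h3⟩
    -- Transport replaces the jumping chart `pick (base x v)` by the fixed chart `pick y₀`. The
    -- result is continuous with values in the `k`-th roots of unity, hence locally constant.
    have hkey : ∀ v ∈ Metric.ball (0 : ℂ) 1, base x v ∈ Pᶜ → base x v ∈ (F.pick y₀).source →
        ((sheet x v * F.transport y₀ (base x v) : CircleRoots k) : Circle) =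
          q x v / dir (F.flat (F.pick y₀) (u x) (base x v)) := by
      intro v hv hvP hvs
      rw [Subgroup.coe_mul, hsheet x v hv hvP, F.coe_transport hy₀' hvP hvs,
        F.dir_flat (F.pick_mem _ hvP) (F.pick_mem _ hy₀') (hL x).mem_maximalAtlas
          (F.mem_pick_source _ hvP) hvs (hsrc x v hv), div_mul_eq_div_div_swap, div_mul_cancel]
    have hconst := hR.eventually_eq_of_pow_eq_one hk (by
      filter_upwards [hgood] with v hv
      rw [← hkey v hv.1 hv.2.1 hv.2.2]
      exact (sheet x v * F.transport y₀ (base x v)).2)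
    filter_upwards [hgood, hconst] with v hv hc
    refine Subtype.ext ?_
    have h1 := hkey v hv.1 hv.2.1 hv.2.2
    have h2 := hkey v₀ hv₀ hbP hbs
    rw [hb₀'] at h2 hc
    exact h1.trans (hc.trans h2.symm)

end FlatCover

/-! ### Velocities of geodesics in flat coordinates. -/

section FlatVelocity

variable {S : Type u} [TopologicalSpace S] [ChartedSpace ℂ S] [IsManifold 𝓘(ℂ, ℂ) ω S]
  {U : Set S} {cov : TangentOperator S} {k : ℕ}

/-- The unit vector in the direction of a complex number, with value zero at zero. -/
def unitVec (v : ℂ) : ℂ := v / ‖v‖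

lemma unitVec_mul {g : ℂ} (hg : g ≠ 0) (v : ℂ) : unitVec (g * v) = dir g * unitVec v := by
  have h : (‖g‖ : ℂ) ≠ 0 := by simpa using hg
  rw [unitVec, unitVec, norm_mul, Complex.ofReal_mul, mul_div_mul_comm]
  congr 1
  rw [div_eq_iff h, mul_comm]
  exact (norm_mul_dir g).symm

/-- Since `unitVec` vanishes only at zero, the statement also covers constant geodesics, with the
factor `1`. -/
lemma exists_pos_smul_of_unitVec_eq {v w : ℂ} (h : unitVec v = unitVec w) :
    ∃ c : ℝ, 0 < c ∧ v = c • w := by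
  by_cases hw : w = 0
  · refine ⟨1, one_pos, ?_⟩
    have h0 : v / ‖v‖ = 0 := by simpa [unitVec, hw] using h
    have hv : v = 0 := by simpa using h0
    simp [hv, hw]
  · by_cases hv : v = 0
    · have h0 : w / ‖w‖ = 0 := by simpa [unitVec, hv] using h.symm
      exact absurd (by simpa using h0) hw
    · refine ⟨‖v‖ / ‖w‖, by positivity, ?_⟩
      have hv' : (‖v‖ : ℂ) ≠ 0 := by simpa using hv
      have hw' : (‖w‖ : ℂ) ≠ 0 := by simpa using hw
      rw [unitVec, unitVec, div_eq_div_iff hv' hw'] at h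
      rw [Complex.real_smul, Complex.ofReal_div, div_mul_eq_mul_div, eq_div_iff hw', h, mul_comm]

namespace FlatAtlas

variable (F : FlatAtlas cov U k)

lemma hasDerivAt_prim {z : OpenPartialHomeomorph S ℂ} (hz : z ∈ F.charts) {x : S}
    (hx : x ∈ z.source) :
    HasDerivAt (F.prim z ∘ z.symm) (localCoeff cov z x) (z x) := by
  have hz' := F.mem_maximalAtlas z hz
  have hd := F.mdifferentiableAt_prim z hz x hx
  have h1 := ((mdifferentiableAt_iff_comp_symm hz' hx).1 hd).hasDerivAt
  rwa [localCoeff, ← F.mvfderiv_prim z hz x hx, mvfderiv_apply_eq hz' hx hd, coordField_eq hz' hx,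
    chartRatio_mul_symm hz' (chartAt_mem_maximalAtlas x) hx (mem_chart_source ℂ x), mul_one]

/-- The velocity of a curve in the flat coordinate of a chart. -/
def velocity (z : OpenPartialHomeomorph S ℂ) (γ : ℝ → S) (I : Set ℝ) (t : ℝ) : ℂ :=
  Complex.exp (F.prim z (γ t)) * derivWithin (z ∘ γ) I t

variable {γ : ℝ → S} {I : Set ℝ} {z w : OpenPartialHomeomorph S ℂ} {t : ℝ}

lemma velocity_change (hγ : IsGeodesicOn cov U γ I) (hz : z ∈ F.charts) (hw : w ∈ F.charts)
    (ht : t ∈ I) (htz : γ t ∈ z.source) (htw : γ t ∈ w.source) :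
    F.velocity z γ I t = F.cocycle z w (γ t) * F.velocity w γ I t := by
  rw [velocity, velocity, derivWithin_chart_change (F.mem_maximalAtlas z hz)
    (F.mem_maximalAtlas w hw) (hγ.ordConnected.uniqueDiffOn_real hγ.nontrivial) ht
    (hγ.smooth t ht) htz htw, cocycle]
  have := Complex.exp_ne_zero (F.prim w (γ t))
  field_simp

lemma hasDerivWithinAt_velocity (hγ : IsGeodesicOn cov U γ I) (hz : z ∈ F.charts)
    (ht : t ∈ I) (htz : γ t ∈ z.source) :
    HasDerivWithinAt (F.velocity z γ I) 0 I t := by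
  have hI := hγ.ordConnected.uniqueDiffOn_real hγ.nontrivial
  have hz' := F.mem_maximalAtlas z hz
  obtain ⟨hcont, hd⟩ := (contMDiffWithinAt_curve_iff hz' htz).1 (hγ.smooth t ht)
  have h1 := (hd.differentiableWithinAt (by simp)).hasDerivWithinAt
  have h2 : HasDerivWithinAt (derivWithin (z ∘ γ) I) (derivWithin (derivWithin (z ∘ γ) I) I t) I t :=
    ((hd.derivWithin hI (m := 1) (by norm_cast) ht).differentiableWithinAt
      (by simp)).hasDerivWithinAt
  have h3 : HasDerivWithinAt (F.prim z ∘ γ) (localCoeff cov z (γ t) * derivWithin (z ∘ γ) I t) I t :=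
    ((F.hasDerivAt_prim hz htz).comp_hasDerivWithinAt (h := z ∘ γ) t h1).congr_of_eventuallyEq (by
      filter_upwards [hcont (z.open_source.mem_nhds htz)] with s hs
      simp [z.left_inv hs]) (by simp [z.left_inv htz])
  have h4 := h3.cexp.mul h2
  refine h4.congr_deriv ?_
  have h5 := hγ.geodesic_eq z hz' t ht htz
  simp only [Function.comp_apply] at h5 ⊢
  -- The derivative of the flat velocity is `exp K` times the left-hand side of the geodesic
  -- equation.
  linear_combination Complex.exp (F.prim z (γ t)) * h5

lemma eventually_velocity_eq (hγ : IsGeodesicOn cov U γ I) (hz : z ∈ F.charts)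
    (ht : t ∈ I) (htz : γ t ∈ z.source) :
    ∀ᶠ s in 𝓝[I] t, F.velocity z γ I s = F.velocity z γ I t := by
  have hcont := (hγ.smooth t ht).continuousWithinAt
  obtain ⟨ε, hε, hball⟩ := Metric.mem_nhdsWithin_iff.1 (hcont (z.open_source.mem_nhds htz))
  filter_upwards [inter_mem_nhdsWithin I (Metric.ball_mem_nhds t hε)] with s hs
  have hconv : Convex ℝ (Metric.ball t ε ∩ I) := (convex_ball t ε).inter hγ.ordConnected.convex
  have h := hconv.norm_image_sub_le_of_norm_hasDerivWithin_le (f := F.velocity z γ I)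
    (f' := fun _ ↦ 0) (C := 0)
    (fun r hr ↦ (F.hasDerivWithinAt_velocity hγ hz hr.2 (hball hr)).mono inter_subset_right)
    (fun _ _ ↦ by simp) (⟨Metric.mem_ball_self hε, ht⟩ : t ∈ Metric.ball t ε ∩ I)
    (⟨hs.2, hs.1⟩ : s ∈ Metric.ball t ε ∩ I)
  rw [zero_mul, norm_le_zero_iff, sub_eq_zero] at h
  exact h

end FlatAtlas

end FlatVelocity

/-! ### Self-intersecting geodesics on the cover are closed. -/

section Closed

variable {S T : Type u} [TopologicalSpace S] [ChartedSpace ℂ S] [IsManifold 𝓘(ℂ, ℂ) ω S]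
  [TopologicalSpace T] [ChartedSpace ℂ T] [IsManifold 𝓘(ℂ, ℂ) ω T]
  {P : Set S} {cov : TangentOperator S} {k : ℕ}

/-- The direction of a geodesic, corrected by the label of the sheet, is constant. -/
lemma FlatAtlas.label_mul_unitVec_velocity_eq (F : FlatAtlas cov Pᶜ k) {π : T → S}
    {label : T → CircleRoots k}
    (hlabel : ∀ t₀ ∈ (π ⁻¹' P)ᶜ, ∀ᶠ t in 𝓝 t₀,
      label t * F.transport (π t₀) (π t) = label t₀ * F.transport (π t₀) (π t₀))
    {σ : ℝ → T} {I : Set ℝ} (hσ : ContinuousOn σ I) (hγ : IsGeodesicOn cov Pᶜ (π ∘ σ) I)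
    {a b : ℝ} (ha : a ∈ I) (hb : b ∈ I) :
    ((label (σ a) : Circle) : ℂ) * unitVec (F.velocity (F.pick (π (σ a))) (π ∘ σ) I a) =
      ((label (σ b) : Circle) : ℂ) * unitVec (F.velocity (F.pick (π (σ b))) (π ∘ σ) I b) := by
  let J : ℝ → ℂ := fun t ↦
    ((label (σ t) : Circle) : ℂ) * unitVec (F.velocity (F.pick (π (σ t))) (π ∘ σ) I t)
  have hJ : IsLocallyConstant fun t : I ↦ J t := by
    rw [IsLocallyConstant.iff_eventually_eq]
    rintro ⟨t₀, ht₀⟩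
    rw [eventually_nhds_subtype_iff I ⟨t₀, ht₀⟩ fun t ↦ J t = J t₀]
    have hP₀ : π (σ t₀) ∈ Pᶜ := hγ.mapsTo ht₀
    have hz := F.pick_mem _ hP₀
    have hzs := F.mem_pick_source _ hP₀
    have hv := F.eventually_velocity_eq hγ hz ht₀ hzs
    -- Passing from the chart picked at `σ t` to the one picked at `σ t₀` costs exactly the
    -- transport factor, which completes the label to a locally constant quantity.
    have key : ∀ t ∈ I, (π ∘ σ) t ∈ (F.pick (π (σ t₀))).source →
        unitVec (F.velocity (F.pick (π (σ t))) (π ∘ σ) I t) =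
          ((F.transport (π (σ t₀)) (π (σ t)) : Circle) : ℂ) *
            unitVec (F.velocity (F.pick (π (σ t₀))) (π ∘ σ) I t) := by
      intro t ht hts
      have hPt : π (σ t) ∈ Pᶜ := hγ.mapsTo ht
      have hc := F.cocycle_ne_zero (F.pick_mem _ hPt) hz (F.mem_pick_source _ hPt) hts
      rw [F.velocity_change hγ (F.pick_mem _ hPt) hz ht (F.mem_pick_source _ hPt) hts,
        Function.comp_apply, unitVec_mul hc, F.coe_transport hP₀ hPt hts]
    filter_upwards [hv, (hσ t₀ ht₀) (hlabel (σ t₀) hP₀), self_mem_nhdsWithin,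
      (hγ.smooth t₀ ht₀).continuousWithinAt ((F.pick (π (σ t₀))).open_source.mem_nhds hzs)]
      with t h1 h2 ht hts
    have h2' : label (σ t) * F.transport (π (σ t₀)) (π (σ t)) =
      label (σ t₀) * F.transport (π (σ t₀)) (π (σ t₀)) := h2
    have h3 := congrArg (fun g : CircleRoots k ↦ ((g : Circle) : ℂ)) h2'
    simp only [Subgroup.coe_mul, Circle.coe_mul] at h3
    simp only [J]
    rw [key t ht hts, key t₀ ht₀ hzs, h1, ← mul_assoc, h3, mul_assoc]
  have : PreconnectedSpace I := isPreconnected_iff_preconnectedSpace.1 hγ.ordConnected.isPreconnected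
  exact hJ.apply_eq_of_preconnectedSpace ⟨a, ha⟩ ⟨b, hb⟩

lemma FlatAtlas.isClosedGeodesic (F : FlatAtlas cov Pᶜ k) {π : T → S} {cov' : TangentOperator T}
    {label : T → CircleRoots k}
    (hlabel : ∀ t₀ ∈ (π ⁻¹' P)ᶜ, ∀ᶠ t in 𝓝 t₀,
      label t * F.transport (π t₀) (π t) = label t₀ * F.transport (π t₀) (π t₀))
    (hbranch : ∀ t ∈ (π ⁻¹' P)ᶜ, ∃ φ : OpenPartialHomeomorph T S, IsBranch π φ ∧ t ∈ φ.source)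
    {σ : ℝ → T} {a b : ℝ} (hab : a < b) (heq : σ a = σ b)
    (hσ : IsGeodesicOn cov' (π ⁻¹' P)ᶜ σ (Icc a b))
    (hγ : IsGeodesicOn cov Pᶜ (π ∘ σ) (Icc a b)) :
    IsClosedGeodesic cov' (π ⁻¹' P)ᶜ σ a b := by
  have ha : a ∈ Icc a b := left_mem_Icc.2 hab.le
  have hb : b ∈ Icc a b := right_mem_Icc.2 hab.le
  refine ⟨hab, hσ, heq.symm, ?_⟩
  have hP : π (σ a) ∈ Pᶜ := hσ.mapsTo ha
  obtain ⟨φ, hφ, hφa⟩ := hbranch (σ a) (hσ.mapsTo ha)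
  set z := F.pick (π (σ a)) with hz_def
  have hz := F.pick_mem _ hP
  have hzs := F.mem_pick_source _ hP
  have hJ := F.label_mul_unitVec_velocity_eq hlabel hσ.smooth.continuousOn hγ ha hb
  rw [← heq] at hJ
  -- Both endpoints are the same point of `T`, so label and picked chart coincide and can be
  -- cancelled, as can the factor `exp K` below.
  have hJ' := mul_left_cancel₀ (Circle.coe_ne_zero _) hJ
  rw [← hz_def, velocity, velocity, unitVec_mul (Complex.exp_ne_zero _),
    unitVec_mul (Complex.exp_ne_zero _)] at hJ'
  simp only [Function.comp_apply, ← heq] at hJ'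
  obtain ⟨c, hc, h⟩ := exists_pos_smul_of_unitVec_eq (mul_left_cancel₀ (Circle.coe_ne_zero _) hJ').symm
  refine ⟨c, hc, ?_⟩
  have hz' := hφ.trans_mem_maximalAtlas (F.mem_maximalAtlas z hz)
  have hsrc : σ a ∈ (φ.trans z).source := hφ.mem_trans_source hφa hzs
  have hI := hσ.ordConnected.uniqueDiffOn_real hσ.nontrivial
  have hcoe : ⇑(φ.trans z) ∘ σ = z ∘ (π ∘ σ) := by rw [hφ.coe_trans]; rfl
  -- Velocities at the common endpoint change from `z ∘ π` to the preferred chart by the same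
  -- complex factor, so the positive ratio is preserved.
  rw [derivWithin_chart_change (chartAt_mem_maximalAtlas (σ a)) hz' hI ha (hσ.smooth a ha)
      (mem_chart_source ℂ _) hsrc,
    derivWithin_chart_change (chartAt_mem_maximalAtlas (σ a)) hz' hI hb (hσ.smooth b hb)
      (heq ▸ mem_chart_source ℂ _) (heq ▸ hsrc), hcoe, h, ← heq, mul_smul_comm]

end Closed

end

theorem mainTheorem5 (S : Type u) [TopologicalSpace S] [ChartedSpace ℂ S]
    [IsManifold 𝓘(ℂ, ℂ) ω S] [T2Space S] [CompactSpace S]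
    [ConnectedSpace S] (P : Set S) (hP : P.Finite)
    (cov : TangentOperator S) (hcov : IsHolomorphicConnectionOn cov Pᶜ)
    (G : Subgroup ℂˣ) (hmon : HasMonodromyIn cov Pᶜ G)
    (k : ℕ) (hk : 0 < k)
    (hG : (fun a : ℂˣ ↦ Complex.arg ((a : ℂ) ^ k)) '' (G : Set ℂˣ) = {0}) :
    ∃ (T : Type u) (_ : TopologicalSpace T) (_ : ChartedSpace ℂ T)
      (_ : IsManifold 𝓘(ℂ, ℂ) ω T) (_ : T2Space T)
      (_ : CompactSpace T) (_ : ConnectedSpace T) (π : T → S) (cov' : TangentOperator T),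
      IsRamifiedCovering π P ∧
      IsHolomorphicConnectionOn cov' (π ⁻¹' P)ᶜ ∧
      (∀ (σ : ℝ → T) (I : Set ℝ), I.OrdConnected → I.Nontrivial →
        ContMDiffOn 𝓘(ℝ, ℝ) 𝓘(ℝ, ℂ) ∞ σ I → Set.MapsTo σ I (π ⁻¹' P)ᶜ →
        (IsGeodesicOn cov' (π ⁻¹' P)ᶜ σ I ↔ IsGeodesicOn cov Pᶜ (π ∘ σ) I)) ∧
      (∀ (σ : ℝ → T) (I : Set ℝ), IsGeodesicOn cov' (π ⁻¹' P)ᶜ σ I →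
        ∀ a ∈ I, ∀ b ∈ I, a < b → σ a = σ b →
          IsClosedGeodesic cov' (π ⁻¹' P)ᶜ σ a b) := by
  have hG' : ∀ a ∈ G, Complex.arg ((a : ℂ) ^ k) = 0 := fun a ha ↦
    hG.le (Set.mem_image_of_mem _ ha)
  obtain ⟨F⟩ := hmon.nonempty_flatAtlas hG'
  obtain ⟨c, hc⟩ := F.exists_coverData hP hk
  have : Finite (CircleRoots k) := finite_circleRoots hk
  obtain ⟨T, _, _, _, _, _, _, π, label, hcover, hbranch, hlabel⟩ := c.exists_connected_cover
  rw [hc] at hlabel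
  have hU : IsOpen Pᶜ := hP.isClosed.isOpen_compl
  have hV : IsOpen (π ⁻¹' P)ᶜ := hU.preimage hcover.holomorphic.continuous
  have hVU : Set.MapsTo π (π ⁻¹' P)ᶜ Pᶜ := fun _ h ↦ h
  have hiff : ∀ (σ : ℝ → T) (I : Set ℝ), I.OrdConnected → I.Nontrivial →
      ContMDiffOn 𝓘(ℝ, ℝ) 𝓘(ℝ, ℂ) ∞ σ I → Set.MapsTo σ I (π ⁻¹' P)ᶜ →
      (IsGeodesicOn (pullbackConnection π cov (π ⁻¹' P)ᶜ hbranch) (π ⁻¹' P)ᶜ σ I ↔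
        IsGeodesicOn cov Pᶜ (π ∘ σ) I) := fun σ I hI hIn hσ hσV ↦
    isGeodesicOn_pullbackConnection_iff hbranch hU hV hcov hVU hI hIn hσ hσV
  refine ⟨T, _, _, inferInstance, inferInstance, inferInstance, inferInstance, π,
    pullbackConnection π cov (π ⁻¹' P)ᶜ hbranch, hcover,
    isHolomorphicConnectionOn_pullbackConnection hbranch hU hcov hVU, hiff, ?_⟩
  intro σ I hσ a ha b hb hab heq
  have h1 := hσ.mono Set.ordConnected_Icc ⟨a, Set.left_mem_Icc.2 hab.le, b,
    Set.right_mem_Icc.2 hab.le, hab.ne⟩ (hσ.ordConnected.out ha hb)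
  exact F.isClosedGeodesic hlabel hbranch hab heq h1
    ((hiff σ _ h1.ordConnected h1.nontrivial h1.smooth h1.mapsTo).1 h1)
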